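/- Let $p,q\ge 1$ be integers. For a probability density $f$ on $\mathbb R^p\times\mathbb R^q$ (w.r.t. Lebesgue measure), let $f_1(x)=\int f(x,y)\,dy$ and $f_2(y)=\int f(x,y)\,dx$ be its marginals, $(f_1\otimes f_2)(x,y)=f_1(x)f_2(y)$, and let $P_f$ be the law of an i.i.d. sample $(X_1,Y_1),\dots,(X_n,Y_n)$ with density $f$. *Test.* For $\lambda\in(0,\infty)^d$ let $k_\lambda(x,x')=\prod_{i=1}^d \frac{1}{\lambda_i\sqrt{2\pi}}\exp\big(-\frac{(x_i-x_i')^2}{2\lambda_i^2}\big)$ for $x,x'\in\mathbb R^d$. For $\lambda\in(0,\infty)^p$, $\mu\in(0,\infty)^q$, let $$\hat H_{\lambda,\mu}=\frac{\sum_{(i,j)} k_\lambda(X_i,X_j)k_\mu(Y_i,Y_j)}{n(n-1)}+\frac{\sum_{(i,j,r,s)} k_\lambda(X_i,X_j)k_\mu(Y_r,Y_s)}{n(n-1)(n-2)(n-3)}-2\,\frac{\sum_{(i,j,r)} k_\lambda(X_i,X_j)k_\mu(Y_j,Y_r)}{n(n-1)(n-2)},$$ the sums being over tuples of pairwise distinct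 indices in $\{1,\dots,n\}$ (a term whose sum is empty is read as $0$ when $n<4$). Let $q_{1-\alpha}^{\lambda,\mu}$ be the $(1-\alpha)$-quantile of $\hat H_{\lambda,\mu}$ under $P_{f_1\otimes f_2}$, and $\Delta_\alpha^{\lambda,\mu}=\mathbf 1\{\hat H_{\lambda,\mu}>q_{1-\alpha}^{\lambda,\mu}\}$. *Class.* For $\delta\in(0,\infty)^d$ and $R>0$, let $\lfloor\delta_i\rfloor$ denote the largest integer strictly less than $\delta_i$, and let $\mathcal N^\delta_{2,d}(R)$ be the set of $s:\mathbb R^d\to\mathbb R$ such that, for each $i$, the partial derivative $D_i^{\lfloor\delta_i\rfloor}s$ of order $\lfloor\delta_i\rfloor$ in the $i$-th variable exists, is continuous, and satisfies $\|D_i^{\lfloor\delta_i\rfloor}s(\cdot+v e_i)-D_i^{\lfloor\delta_i\rfloor}s\|_2\le R|v|^{\delta_i-\lfloor\delta_i\rfloor}$ for all $v\in\mathbb R$ ($e_i$ the $i$-th basis vector). Let $\mathcal N^\delta_{2,p+q}(R,R')$ be the class of densities $f$ with $f-f_1\otimes f_2\in\mathcal N^\delta_{2,p+q}(R)$ and $\max\{\|f\|_\infty,\|f_1\|_\infty,\|f_2\|_\infty\}\le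 R'$. *Rate.* The uniform separation rate of a test $\Delta$ over a class $\mathcal C$ is $$\rho(\Delta,\mathcal C,\beta)=\inf\Big\{\rho>0:\ \sup_{f\in\mathcal C,\ \|f-f_1\otimes f_2\|_2>\rho}P_f(\Delta=0)\le\beta\Big\}.$$ *Statement.* Let $\alpha\in(0,1/e)$, $\beta\in(0,1)$, $\delta=(\nu_1,\dots,\nu_p,\gamma_1,\dots,\gamma_q)\in(0,2]^{p+q}$ and $R,R'>0$. Put $$\frac1\eta=\sum_{i=1}^p\frac1{\nu_i}+\sum_{j=1}^q\frac1{\gamma_j},\qquad \lambda_i^*=n^{-2\eta/[\nu_i(1+4\eta)]},\qquad \mu_j^*=n^{-2\eta/[\gamma_j(1+4\eta)]}.$$ There is a constant $C=C(p,q,\alpha,\beta,\delta,R,R')>0$ such that, for every integer $n\ge(\log(1/\alpha))^{1+1/(4\eta)}$, $$\rho\big(\Delta_\alpha^{\lambda^*,\mu^*},\mathcal N^\delta_{2,p+q}(R,R'),\beta\big)\le C\,n^{-2\eta/(1+4\eta)}.$$ Moreover, for every integer $n>(\log(1/\alpha))^{1+1/(4\eta)}$, the bandwidths satisfy $$\max\Big\{\prod_{i}\lambda_i^*,\prod_{j}\mu_j^*\Big\}<1\quad\text{and}\quad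 n\sqrt{\lambda_1^*\cdots\lambda_p^*\,\mu_1^*\cdots\mu_q^*}>\log(1/\alpha)>1.$$ -/

import Mathlib

open MeasureTheory
open scoped ENNReal

noncomputable section

namespace HSIC

/-! ### Gaussian kernels -/

/-- The density `g_d` of the standard Gaussian distribution on `ℝ^d`. -/
def gaussianDensity {d : ℕ} (x : Fin d → ℝ) : ℝ :=
  1 / (2 * Real.pi) ^ ((d : ℝ) / 2) * Real.exp (-(1 / 2) * ∑ i, x i ^ 2)

/-- The rescaled Gaussian density with bandwidth vector `lam`. -/
def scaledGaussian {d : ℕ} (lam : Fin d → ℝ) (x : Fin d → ℝ) : ℝ :=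
  1 / (∏ i, lam i) * gaussianDensity (fun i => x i / lam i)

/-- The Gaussian kernel with bandwidth vector `lam`. -/
def gaussianKernel {d : ℕ} (lam : Fin d → ℝ) (x x' : Fin d → ℝ) : ℝ :=
  scaledGaussian lam (fun i => x i - x' i)

/-! ### The statistic. A tuple drawn without replacement from `{1, …, n}` is an
injective map into `Fin n`. -/

/-- A point of `ℝ^p × ℝ^q`. -/
abbrev Obs (p q : ℕ) : Type := (Fin p → ℝ) × (Fin q → ℝ)

/-- U-statistic of order 2. -/
def hsic2 {p q : ℕ} (n : ℕ) (lam : Fin p → ℝ) (mu : Fin q → ℝ) (z : Fin n → Obs p q) : ℝ :=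
  1 / ((n : ℝ) * ((n : ℝ) - 1)) *
    ∑ t : Fin 2 ↪ Fin n,
      gaussianKernel lam (z (t 0)).1 (z (t 1)).1 * gaussianKernel mu (z (t 0)).2 (z (t 1)).2

/-- U-statistic of order 3. -/
def hsic3 {p q : ℕ} (n : ℕ) (lam : Fin p → ℝ) (mu : Fin q → ℝ) (z : Fin n → Obs p q) : ℝ :=
  1 / ((n : ℝ) * ((n : ℝ) - 1) * ((n : ℝ) - 2)) *
    ∑ t : Fin 3 ↪ Fin n,
      gaussianKernel lam (z (t 0)).1 (z (t 1)).1 * gaussianKernel mu (z (t 1)).2 (z (t 2)).2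

/-- U-statistic of order 4. -/
def hsic4 {p q : ℕ} (n : ℕ) (lam : Fin p → ℝ) (mu : Fin q → ℝ) (z : Fin n → Obs p q) : ℝ :=
  1 / ((n : ℝ) * ((n : ℝ) - 1) * ((n : ℝ) - 2) * ((n : ℝ) - 3)) *
    ∑ t : Fin 4 ↪ Fin n,
      gaussianKernel lam (z (t 0)).1 (z (t 1)).1 * gaussianKernel mu (z (t 2)).2 (z (t 3)).2

/-- The estimator of HSIC. -/
def hsicStat {p q : ℕ} (n : ℕ) (lam : Fin p → ℝ) (mu : Fin q → ℝ) (z : Fin n → Obs p q) : ℝ :=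
  hsic2 n lam mu z + hsic4 n lam mu z - 2 * hsic3 n lam mu z

/-! ### Densities, marginals and sampling distributions -/

/-- `f` is a probability density with respect to Lebesgue measure on `ℝ^p × ℝ^q`. -/
def IsDensity {p q : ℕ} (f : Obs p q → ℝ) : Prop :=
  Measurable f ∧ (∀ z, 0 ≤ f z) ∧ ∫⁻ z, ENNReal.ofReal (f z) = 1

/-- First marginal density `f₁`. -/
def marginalX {p q : ℕ} (f : Obs p q → ℝ) (x : Fin p → ℝ) : ℝ := ∫ y, f (x, y)

/-- Second marginal density `f₂`. -/
def marginalY {p q : ℕ} (f : Obs p q → ℝ) (y : Fin q → ℝ) : ℝ := ∫ x, f (x, y)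

/-- The product of the marginals, `f₁ ⊗ f₂`. -/
def productOfMarginals {p q : ℕ} (f : Obs p q → ℝ) : Obs p q → ℝ :=
  fun z => marginalX f z.1 * marginalY f z.2

/-- The difference `f - f₁ ⊗ f₂`. -/
def dependencePart {p q : ℕ} (f : Obs p q → ℝ) : Obs p q → ℝ :=
  fun z => f z - productOfMarginals f z

/-- The law `P_f` of an i.i.d. `n`-sample with common density `f`. -/
def sampleLaw {p q : ℕ} (n : ℕ) (f : Obs p q → ℝ) : Measure (Fin n → Obs p q) :=
  Measure.pi fun _ => (volume : Measure (Obs p q)).withDensity fun z => ENNReal.ofReal (f z)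

/-! ### The single test -/

/-- The `u`-quantile of the statistic `T` under `P`: the least `t` with `P(T ≤ t) ≥ u`. -/
def quantile {Ω : Type*} [MeasurableSpace Ω] (P : Measure Ω) (T : Ω → ℝ) (u : ℝ) : ℝ :=
  sInf {t : ℝ | ENNReal.ofReal u ≤ P {ω | T ω ≤ t}}

/-- The theoretical single test (value `1`: independence is rejected). Its critical value is
the `(1 - α)`-quantile of the statistic under `P_{f₁ ⊗ f₂}`, hence depends on the marginals
of the density `f`. -/
def hsicTest {p q : ℕ} (n : ℕ) (α : ℝ) (lam : Fin p → ℝ) (mu : Fin q → ℝ)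
    (f : Obs p q → ℝ) (z : Fin n → Obs p q) : ℕ :=
  if quantile (sampleLaw n (productOfMarginals f)) (hsicStat n lam mu) (1 - α)
      < hsicStat n lam mu z then 1 else 0

/-- The conditions imposed on the bandwidths, for the level `α` and the sample size `n`. -/
def BandwidthCondition {p q : ℕ} (n : ℕ) (α : ℝ) (lam : Fin p → ℝ) (mu : Fin q → ℝ) : Prop :=
  max (∏ i, lam i) (∏ j, mu j) < 1 ∧
    Real.log (1 / α) < (n : ℝ) * Real.sqrt ((∏ i, lam i) * ∏ j, mu j) ∧
    1 < Real.log (1 / α)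

/-! ### Uniform separation rate -/

/-- The uniform separation rate, with respect to the `L²` norm, of a test `Δ` over a class
`𝒞` of densities: the infimum, in `[0, ∞]`, of the `ρ > 0` such that the supremum of the
second kind errors over the `f ∈ 𝒞` with `‖f - f₁ ⊗ f₂‖₂ > ρ` is at most `β`. As the critical
value of the test, `Δ` may depend on the density. -/
def separationRate {p q : ℕ} (n : ℕ) (Δ : (Obs p q → ℝ) → (Fin n → Obs p q) → ℕ)
    (𝒞 : Set (Obs p q → ℝ)) (β : ℝ) : ℝ≥0∞ :=
  sInf {r : ℝ≥0∞ | ∃ ρ : ℝ, 0 < ρ ∧ r = ENNReal.ofReal ρ ∧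
    (⨆ f ∈ {f | f ∈ 𝒞 ∧ ENNReal.ofReal ρ < eLpNorm (dependencePart f) 2 volume},
      sampleLaw n f {z | Δ f z = 0}) ≤ ENNReal.ofReal β}

/-! ### Anisotropic Nikol'skii-Besov balls -/

/-- The partial derivative of order `k` of `s` in the `i`-th coordinate. -/
def partialDeriv {ι : Type*} [DecidableEq ι] (i : ι) (k : ℕ) (s : (ι → ℝ) → ℝ)
    (u : ι → ℝ) : ℝ :=
  iteratedDeriv k (fun t : ℝ => s (Function.update u i t)) (u i)

/-- The largest integer strictly less than `r` (for `r > 0`), that is the integer part of `r`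
if `r` is not an integer, and `r - 1` otherwise. -/
def strictFloor (r : ℝ) : ℕ := ⌈r⌉₊ - 1

/-- The anisotropic Nikol'skii-Besov ball with regularity `δ` and radius `R` on `ℝ^ι`: for
each coordinate `i`, with `k` the strict integer part of `δ i`, the partial derivative of
order `k` in the `i`-th coordinate exists everywhere, is continuous, and is
`(δ i - k)`-Hölder in the `L²` sense along that coordinate. -/
def nikolskiiBall {ι : Type*} [Fintype ι] [DecidableEq ι] (δ : ι → ℝ) (R : ℝ) :
    Set ((ι → ℝ) → ℝ) :=
  {s | ∀ i : ι,
    (∀ u : ι → ℝ, ContDiff ℝ (strictFloor (δ i) : ℕ) fun t : ℝ => s (Function.update u i t)) ∧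
    Continuous (partialDeriv i (strictFloor (δ i)) s) ∧
    ∀ v : ℝ,
      eLpNorm (fun u => partialDeriv i (strictFloor (δ i)) s (Function.update u i (u i + v))
          - partialDeriv i (strictFloor (δ i)) s u) 2 volume
        ≤ ENNReal.ofReal (R * |v| ^ (δ i - (strictFloor (δ i) : ℝ)))}

/-- A function on `ℝ^p × ℝ^q` seen as a function of `p + q` real coordinates. -/
def toCoordinates {p q : ℕ} (s : Obs p q → ℝ) : (Fin p ⊕ Fin q → ℝ) → ℝ :=
  fun u => s (fun i => u (Sum.inl i), fun j => u (Sum.inr j))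

/-- The class of densities `f` such that `f - f₁ ⊗ f₂` is in the Nikol'skii-Besov ball with
regularity `(ν₁, …, ν_p, γ₁, …, γ_q)` and radius `R`, and such that the sup norms of `f`, `f₁`
and `f₂` are at most `R'`. -/
def nikolskiiClass {p q : ℕ} (ν : Fin p → ℝ) (γ : Fin q → ℝ) (R R' : ℝ) :
    Set (Obs p q → ℝ) :=
  {f | IsDensity f ∧
    toCoordinates (dependencePart f) ∈ nikolskiiBall (Sum.elim ν γ) R ∧
    max (eLpNorm f ∞ volume)
        (max (eLpNorm (marginalX f) ∞ volume) (eLpNorm (marginalY f) ∞ volume))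
      ≤ ENNReal.ofReal R'}

/-- The bandwidths `n ^ (-2η / (r_i (1 + 4η)))` attached to the regularities `r_i`. -/
def optimalBandwidth {d : ℕ} (n : ℕ) (η : ℝ) (r : Fin d → ℝ) : Fin d → ℝ :=
  fun i => (n : ℝ) ^ (-(2 * η) / (r i * (1 + 4 * η)))

end HSIC

end

noncomputable section

namespace HSIC

/-! ### Averages over permutations -/

/-! Write `ψ = f - f₁ ⊗ f₂` and let `G` be `ψ` smoothed by the product Gaussian kernel. For `n ≥ 4`
the statistic has mean `θ = ∫ ψ G`, and polarisation (`integral_mul_gaussianSmooth_eq`) gives `2θ =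
‖ψ‖² + ‖G‖² - ‖ψ - G‖²`. The test therefore detects `f` once `‖ψ‖²` dominates the squared smoothing
bias, the critical value and the standard deviation of the statistic (`second_kind_error_le`).

Fluctuations. The statistic is an average, over permutations of the sample, of an interaction
between two disjoint pairs of observations (`sum_perm_pairKernel`). Grouping `4m ≤ n` observations
into two independent samples of `m` pairs and using convexity of the square, its mean square
deviation is at most that of a two-sample average (`integral_hsicStat_sub_sq_le`), which needs only
two conditioned sample means (`integral_twoSample_sq_le`) and no full Hoeffding decomposition. Up to
constants the result is `‖G‖² / n + 1 / (n² ∏ λ ∏ μ)`. Under independence `ψ` and `G` vanish, so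
only the second term remains, and Chebyshev's inequality bounds the quantile. The level `α` is fixed
and may enter the constant, so no exponential inequality is needed. Under the alternative, the
`‖G‖²` in `θ` absorbs the first variance term.

Bias. The Gaussian is even, so smoothing one coordinate produces symmetric second differences.
Regularity at most two bounds these in `L²` by `|h| ^ δ i`, and the coordinates are smoothed one
after another (`eLpNorm_sub_partialSmooth_le`). Hence `‖ψ - G‖` is of order `∑ λ_i ^ ν_i + ∑ μ_j ^
γ_j`.

Balance. With `r = n ^ (-2η / (1 + 4η))` every `λ_i ^ ν_i` and `μ_j ^ γ_j` equals `r`, and `1 / (n²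
∏ λ ∏ μ) = r⁴`. Squared bias and critical value are thus both of order `r²`. -/

theorem sum_perm_div_eq_sum_embedding_div {n k : ℕ} (F : (Fin k ↪ Fin n) → ℝ)
    (t : Fin k ↪ Fin n) :
    (∑ σ : Equiv.Perm (Fin n), F (t.trans σ.toEmbedding)) / (n.factorial : ℝ) =
      (∑ s, F s) / (n.descFactorial k : ℝ) := by
  classical
  -- Permutations act transitively on injective tuples, so the sum over the group does not depend on
  -- the base tuple.
  have hind : ∀ t' : Fin k ↪ Fin n, ∑ σ : Equiv.Perm (Fin n), F (t'.trans σ.toEmbedding) =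
      ∑ σ : Equiv.Perm (Fin n), F (t.trans σ.toEmbedding) := by
    intro t'
    obtain ⟨τ, hτ⟩ := Equiv.Perm.exists_extending_pair t' t t'.injective t.injective
    refine (Fintype.sum_equiv (Equiv.mulRight τ) _ _ fun σ => ?_).symm
    congr 1
    ext i
    have := hτ i
    simp_all
  -- Double counting: for fixed `σ`, composition with `σ` is a bijection of the set of injective
  -- tuples.
  have hdouble : ∑ t' : Fin k ↪ Fin n, ∑ σ : Equiv.Perm (Fin n), F (t'.trans σ.toEmbedding) =
      (n.factorial : ℝ) * ∑ s, F s := by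
    rw [Finset.sum_comm]
    have : ∀ σ : Equiv.Perm (Fin n), ∑ t' : Fin k ↪ Fin n, F (t'.trans σ.toEmbedding) =
        ∑ s, F s := by
      intro σ
      refine Fintype.sum_equiv (Equiv.embeddingCongr (Equiv.refl _) σ) _ _ fun t' => ?_
      congr 1
    simp [this, Fintype.card_perm]
  have hcard : (Fintype.card (Fin k ↪ Fin n) : ℝ) = n.descFactorial k := by
    simp
  have hpos : (n.descFactorial k : ℝ) ≠ 0 := by
    rw [← hcard]
    have : Nonempty (Fin k ↪ Fin n) := ⟨t⟩
    exact_mod_cast Fintype.card_ne_zero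
  simp only [hind, Finset.sum_const, Finset.card_univ, nsmul_eq_mul, hcard] at hdouble
  rw [div_eq_div_iff (by positivity) hpos]
  linarith

theorem sum_perm_div_two {n : ℕ} (F : Fin n → Fin n → ℝ) {a b : Fin n} (hab : a ≠ b) :
    (∑ σ : Equiv.Perm (Fin n), F (σ a) (σ b)) / (n.factorial : ℝ) =
      1 / ((n : ℝ) * ((n : ℝ) - 1)) * ∑ t : Fin 2 ↪ Fin n, F (t 0) (t 1) := by
  have hinj : Function.Injective ![a, b] := by
    intro i j; fin_cases i <;> fin_cases j <;> simp [hab, hab.symm]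
  have h := sum_perm_div_eq_sum_embedding_div (fun t => F (t 0) (t 1)) ⟨![a, b], hinj⟩
  have hn : 2 ≤ n := by simpa using Fintype.card_le_of_injective _ hinj
  have hc : ((n.descFactorial 2 : ℕ) : ℝ) = n * ((n : ℝ) - 1) := by
    simp only [Nat.descFactorial, Nat.sub_zero]
    push_cast [Nat.cast_sub (by omega : 1 ≤ n)]
    ring
  rw [hc] at h
  simpa [div_eq_inv_mul] using h

theorem sum_perm_div_three {n : ℕ} (F : Fin n → Fin n → Fin n → ℝ) {a b c : Fin n}
    (hab : a ≠ b) (hac : a ≠ c) (hbc : b ≠ c) :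
    (∑ σ : Equiv.Perm (Fin n), F (σ a) (σ b) (σ c)) / (n.factorial : ℝ) =
      1 / ((n : ℝ) * ((n : ℝ) - 1) * ((n : ℝ) - 2)) *
        ∑ t : Fin 3 ↪ Fin n, F (t 0) (t 1) (t 2) := by
  have hinj : Function.Injective ![a, b, c] := by
    intro i j
    fin_cases i <;> fin_cases j <;> simp [hab, hac, hbc, hab.symm, hac.symm, hbc.symm]
  have h := sum_perm_div_eq_sum_embedding_div (fun t => F (t 0) (t 1) (t 2)) ⟨![a, b, c], hinj⟩
  have hn : 3 ≤ n := by simpa using Fintype.card_le_of_injective _ hinj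
  have hc : ((n.descFactorial 3 : ℕ) : ℝ) = n * ((n : ℝ) - 1) * ((n : ℝ) - 2) := by
    simp only [Nat.descFactorial, Nat.sub_zero]
    push_cast [Nat.cast_sub (by omega : 1 ≤ n), Nat.cast_sub (by omega : 2 ≤ n)]
    ring
  rw [hc] at h
  simpa [div_eq_inv_mul] using h

theorem sum_perm_div_four {n : ℕ} (F : Fin n → Fin n → Fin n → Fin n → ℝ) {a b c d : Fin n}
    (hab : a ≠ b) (hac : a ≠ c) (had : a ≠ d) (hbc : b ≠ c) (hbd : b ≠ d) (hcd : c ≠ d) :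
    (∑ σ : Equiv.Perm (Fin n), F (σ a) (σ b) (σ c) (σ d)) / (n.factorial : ℝ) =
      1 / ((n : ℝ) * ((n : ℝ) - 1) * ((n : ℝ) - 2) * ((n : ℝ) - 3)) *
        ∑ t : Fin 4 ↪ Fin n, F (t 0) (t 1) (t 2) (t 3) := by
  have hinj : Function.Injective ![a, b, c, d] := by
    intro i j
    fin_cases i <;> fin_cases j <;> simp [hab, hac, hbc, hab.symm, hac.symm, hbc.symm, had,
      hbd, hcd, had.symm, hbd.symm, hcd.symm]
  have h := sum_perm_div_eq_sum_embedding_div (fun t => F (t 0) (t 1) (t 2) (t 3))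
    ⟨![a, b, c, d], hinj⟩
  have hn : 4 ≤ n := by simpa using Fintype.card_le_of_injective _ hinj
  have hc : ((n.descFactorial 4 : ℕ) : ℝ) =
      n * ((n : ℝ) - 1) * ((n : ℝ) - 2) * ((n : ℝ) - 3) := by
    simp only [Nat.descFactorial, Nat.sub_zero]
    push_cast [Nat.cast_sub (by omega : 1 ≤ n), Nat.cast_sub (by omega : 2 ≤ n),
      Nat.cast_sub (by omega : 3 ≤ n)]
    ring
  rw [hc] at h
  simpa [div_eq_inv_mul] using h

/-! ### The symmetrised kernel of the estimator -/

/-- The interaction of two pairs of observations: the product over the two components of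
the double differences of the kernels. -/
def pairKernel {X Y : Type*} (k : X → X → ℝ) (l : Y → Y → ℝ) (w w' : (X × Y) × (X × Y)) : ℝ :=
  1 / 4 * ((k w.1.1 w'.1.1 - k w.1.1 w'.2.1 - k w.2.1 w'.1.1 + k w.2.1 w'.2.1) *
    (l w.1.2 w'.1.2 - l w.1.2 w'.2.2 - l w.2.2 w'.1.2 + l w.2.2 w'.2.2))

theorem pairKernel_comm {X Y : Type*} {k : X → X → ℝ} {l : Y → Y → ℝ}
    (hk : ∀ x x', k x x' = k x' x) (hl : ∀ y y', l y y' = l y' y) (w w' : (X × Y) × (X × Y)) :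
    pairKernel k l w w' = pairKernel k l w' w := by
  unfold pairKernel
  rw [hk w'.1.1, hk w'.1.1, hk w'.2.1, hk w'.2.1, hl w'.1.2, hl w'.1.2, hl w'.2.2, hl w'.2.2]
  ring

theorem gaussianKernel_comm {d : ℕ} (lam : Fin d → ℝ) (x x' : Fin d → ℝ) :
    gaussianKernel lam x x' = gaussianKernel lam x' x := by
  unfold gaussianKernel scaledGaussian gaussianDensity
  congr 4
  refine Finset.sum_congr rfl fun i _ => ?_
  ring

/-- The estimator is the average over all permutations of the sample of the interaction of two
fixed disjoint pairs of observations. -/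
theorem sum_perm_pairKernel {p q : ℕ} {n : ℕ} (lam : Fin p → ℝ) (mu : Fin q → ℝ)
    (z : Fin n → Obs p q) {a b c d : Fin n}
    (hab : a ≠ b) (hac : a ≠ c) (had : a ≠ d) (hbc : b ≠ c) (hbd : b ≠ d) (hcd : c ≠ d) :
    (∑ σ : Equiv.Perm (Fin n), pairKernel (gaussianKernel lam) (gaussianKernel mu)
      (z (σ a), z (σ b)) (z (σ c), z (σ d))) / (n.factorial : ℝ) = hsicStat n lam mu z := by
  set κ : Fin n → Fin n → ℝ := fun i j => gaussianKernel lam (z i).1 (z j).1 with hκ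
  set τ : Fin n → Fin n → ℝ := fun i j => gaussianKernel mu (z i).2 (z j).2 with hτ
  have κc : ∀ i j, κ i j = κ j i := fun i j => gaussianKernel_comm _ _ _
  have τc : ∀ i j, τ i j = τ j i := fun i j => gaussianKernel_comm _ _ _
  have two : ∀ {i j : Fin n}, i ≠ j → (∑ σ : Equiv.Perm (Fin n), κ (σ i) (σ j) * τ (σ i) (σ j)) =
      n.factorial * hsic2 n lam mu z := by
    intro i j hij
    rw [mul_comm, ← div_eq_iff (by positivity)]
    exact sum_perm_div_two (fun i j => κ i j * τ i j) hij
  have three : ∀ {i j r : Fin n}, i ≠ j → i ≠ r → j ≠ r →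
      (∑ σ : Equiv.Perm (Fin n), κ (σ i) (σ j) * τ (σ j) (σ r)) =
      n.factorial * hsic3 n lam mu z := by
    intro i j r hij hir hjr
    rw [mul_comm, ← div_eq_iff (by positivity)]
    exact sum_perm_div_three (fun i j r => κ i j * τ j r) hij hir hjr
  have four : ∀ {i j r s : Fin n}, i ≠ j → i ≠ r → i ≠ s → j ≠ r → j ≠ s → r ≠ s →
      (∑ σ : Equiv.Perm (Fin n), κ (σ i) (σ j) * τ (σ r) (σ s)) =
      n.factorial * hsic4 n lam mu z := by
    intro i j r s h1 h2 h3 h4 h5 h6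
    rw [mul_comm, ← div_eq_iff (by positivity)]
    exact sum_perm_div_four (fun i j r s => κ i j * τ r s) h1 h2 h3 h4 h5 h6
  rw [div_eq_iff (by positivity)]
  -- Of the sixteen products, four use the same index pair in both kernels, four use disjoint index
  -- pairs and eight share exactly one index. The factor `1 / 4` turns the counts 4, 4, 8 into the
  -- coefficients 1, 1, 2 of the statistic. Kernel symmetry is used to write each mixed product with
  -- its shared index in the middle.
  have key : ∀ σ : Equiv.Perm (Fin n), pairKernel (gaussianKernel lam) (gaussianKernel mu)
      (z (σ a), z (σ b)) (z (σ c), z (σ d)) =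
      1 / 4 * ((κ (σ a) (σ c) * τ (σ a) (σ c) + κ (σ a) (σ d) * τ (σ a) (σ d)
        + κ (σ b) (σ c) * τ (σ b) (σ c) + κ (σ b) (σ d) * τ (σ b) (σ d))
        + (κ (σ a) (σ c) * τ (σ b) (σ d) + κ (σ a) (σ d) * τ (σ b) (σ c)
        + κ (σ b) (σ c) * τ (σ a) (σ d) + κ (σ b) (σ d) * τ (σ a) (σ c))
        - (κ (σ c) (σ a) * τ (σ a) (σ d) + κ (σ a) (σ c) * τ (σ c) (σ b)
        + κ (σ d) (σ a) * τ (σ a) (σ c) + κ (σ a) (σ d) * τ (σ d) (σ b)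
        + κ (σ b) (σ c) * τ (σ c) (σ a) + κ (σ c) (σ b) * τ (σ b) (σ d)
        + κ (σ d) (σ b) * τ (σ b) (σ c) + κ (σ b) (σ d) * τ (σ d) (σ a))) := by
    intro σ
    change 1 / 4 * ((κ (σ a) (σ c) - κ (σ a) (σ d) - κ (σ b) (σ c) + κ (σ b) (σ d)) *
      (τ (σ a) (σ c) - τ (σ a) (σ d) - τ (σ b) (σ c) + τ (σ b) (σ d))) = _
    rw [κc (σ c), κc (σ c), κc (σ d), κc (σ d), τc (σ c), τc (σ c), τc (σ d), τc (σ d)]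
    ring
  simp only [key, ← Finset.mul_sum, Finset.sum_sub_distrib, Finset.sum_add_distrib]
  rw [two hac, two had, two hbc, two hbd,
    four hac hab had hbc.symm hcd hbd, four had hab hac hbd.symm hcd.symm hbc,
    four hbc hab.symm hbd hac.symm hcd had, four hbd hab.symm hbc had.symm hcd.symm hac,
    three hac.symm hcd had, three hac hab hbc.symm, three had.symm hcd.symm hac,
    three had hab hbd.symm, three hbc hab.symm hac.symm, three hbc.symm hcd hbd,
    three hbd.symm hcd.symm hbc, three hbd hab.symm had.symm]
  unfold hsicStat
  ring

/-! ### Second moments of sample means -/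

theorem integrable_of_abs_le {Ω : Type*} [MeasurableSpace Ω] {μ : Measure Ω} [IsFiniteMeasure μ]
    {φ : Ω → ℝ} (hφ : Measurable φ) {K : ℝ} (hK : ∀ ω, |φ ω| ≤ K) : Integrable φ μ :=
  Integrable.of_bound hφ.aestronglyMeasurable K (ae_of_all _ hK)

theorem integrable_sq_of_abs_le {Ω : Type*} [MeasurableSpace Ω] {μ : Measure Ω}
    [IsFiniteMeasure μ] {φ : Ω → ℝ} (hφ : Measurable φ) {K : ℝ} (hK : ∀ ω, |φ ω| ≤ K) :
    Integrable (fun ω => φ ω ^ 2) μ := by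
  refine integrable_of_abs_le (hφ.pow_const 2) (K := K ^ 2) fun ω => ?_
  rw [abs_pow]
  exact pow_le_pow_left₀ (abs_nonneg _) (hK ω) 2

/-- The second moment is the squared mean plus the variance over `m`, and the variance is at most
the second moment. The mean is kept because the lemma is also applied to conditional averages that
are not centred. The bound `K` only provides integrability. -/
theorem integral_sampleMean_sq_le {E : Type*} [MeasurableSpace E] (ν : Measure E)
    [IsProbabilityMeasure ν] {m : ℕ} (hm : 0 < m) {φ : E → ℝ} (hφ : Measurable φ) {K : ℝ}
    (hK : ∀ x, |φ x| ≤ K) :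
    ∫ x, ((∑ a, φ (x a)) / m) ^ 2 ∂(Measure.pi fun _ : Fin m => ν) ≤
      (∫ x, φ x ∂ν) ^ 2 + (∫ x, φ x ^ 2 ∂ν) / m := by
  have hL : MemLp φ 2 ν := MemLp.of_bound hφ.aestronglyMeasurable K (ae_of_all _ hK)
  have hm' : (0 : ℝ) < m := by exact_mod_cast hm
  have hvar := ProbabilityTheory.variance_sum_pi (μ := fun _ : Fin m => ν) (X := fun _ => φ)
    (fun _ => hL)
  have hS : MemLp (∑ i : Fin m, fun ω : Fin m → E => φ (ω i)) 2
      (Measure.pi fun _ : Fin m => ν) :=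
    memLp_finsetSum' _ fun i _ => hL.comp_measurePreserving (measurePreserving_eval _ i)
  have hev : ∀ i : Fin m, ∫ ω : Fin m → E, φ (ω i) ∂(Measure.pi fun _ : Fin m => ν) =
      ∫ x, φ x ∂ν := by
    intro i
    have hp := measurePreserving_eval (fun _ : Fin m => ν) i
    have h := integral_map (μ := Measure.pi fun _ : Fin m => ν) hp.measurable.aemeasurable
      (f := φ) hφ.aestronglyMeasurable
    rw [hp.map_eq] at h
    exact h.symm
  have hmean : ∫ ω, (∑ i : Fin m, fun ω : Fin m → E => φ (ω i)) ω
      ∂(Measure.pi fun _ : Fin m => ν) = m * ∫ x, φ x ∂ν := by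
    simp only [Finset.sum_apply]
    rw [integral_finsetSum _ fun i _ => integrable_of_abs_le (by fun_prop) fun ω => hK _]
    simp [hev]
  rw [ProbabilityTheory.variance_eq_sub hS, hmean] at hvar
  simp only [Finset.sum_const, Finset.card_univ, Fintype.card_fin, nsmul_eq_mul,
    Pi.pow_apply, Finset.sum_apply] at hvar
  have hv : ProbabilityTheory.variance φ ν ≤ ∫ x, φ x ^ 2 ∂ν := by
    rw [ProbabilityTheory.variance_eq_sub hL]
    simp only [Pi.pow_apply]
    nlinarith [sq_nonneg (∫ x, φ x ∂ν)]
  simp only [div_pow]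
  rw [integral_div, div_le_iff₀ (by positivity)]
  have e : ((∫ x, φ x ∂ν) ^ 2 + (∫ x, φ x ^ 2 ∂ν) / m) * (m : ℝ) ^ 2 =
      m ^ 2 * (∫ x, φ x ∂ν) ^ 2 + m * ∫ x, φ x ^ 2 ∂ν := by
    field_simp
  rw [e]
  nlinarith

/-! ### Two-sample `U`-statistics -/

theorem abs_sum_div_card_le {m : ℕ} (hm : 0 < m) {c : Fin m → ℝ} {K : ℝ} (hc : ∀ a, |c a| ≤ K) :
    |(∑ a, c a) / m| ≤ K := by
  have hm' : (0 : ℝ) < m := by exact_mod_cast hm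
  rw [abs_div, abs_of_pos hm', div_le_iff₀ hm']
  calc |∑ a, c a| ≤ ∑ a, |c a| := Finset.abs_sum_le_sum_abs _ _
    _ ≤ ∑ _a : Fin m, K := Finset.sum_le_sum fun a _ => hc a
    _ = K * m := by simp [mul_comm]

theorem abs_integral_le_of_abs_le {Ω : Type*} [MeasurableSpace Ω] {μ : Measure Ω}
    [IsProbabilityMeasure μ] {φ : Ω → ℝ} {K : ℝ} (hK : ∀ ω, |φ ω| ≤ K) : |∫ ω, φ ω ∂μ| ≤ K := by
  simpa using norm_integral_le_of_norm_le_const (μ := μ) (f := φ) (C := K) (ae_of_all _ hK)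

theorem integral_sub_integral_sq_le {Ω : Type*} [MeasurableSpace Ω] {μ : Measure Ω}
    [IsProbabilityMeasure μ] {φ : Ω → ℝ} (hφ : Measurable φ) {K : ℝ} (hK : ∀ ω, |φ ω| ≤ K) :
    ∫ ω, (φ ω - ∫ ω, φ ω ∂μ) ^ 2 ∂μ ≤ ∫ ω, φ ω ^ 2 ∂μ := by
  have hL : MemLp φ 2 μ := MemLp.of_bound hφ.aestronglyMeasurable K (ae_of_all _ hK)
  rw [← ProbabilityTheory.variance_eq_integral hφ.aemeasurable,
    ProbabilityTheory.variance_eq_sub hL]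
  simp only [Pi.pow_apply]
  nlinarith [sq_nonneg (∫ x, φ x ∂μ)]

/-- Given the first sample, the statistic is a mean of `m` independent terms, so
`integral_sampleMean_sq_le` applies to the second sample and then to the first. The one-sided
projections contribute `s₁ / m` each, and the full kernel contributes `s₂ / m²`. -/
theorem integral_twoSample_sq_le {E : Type*} [MeasurableSpace E] (ν : Measure E)
    [IsProbabilityMeasure ν] {m : ℕ} (hm : 0 < m) {H : E → E → ℝ}
    (hH : Measurable (Function.uncurry H)) {K : ℝ} (hK : ∀ w w', |H w w'| ≤ K)
    {s₁ s₂ : ℝ} (hs₁ : ∫ w, (∫ w', H w w' ∂ν) ^ 2 ∂ν ≤ s₁)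
    (hs₁' : ∫ w', (∫ w, H w w' ∂ν) ^ 2 ∂ν ≤ s₁) (hs₂ : ∀ w', ∫ w, H w w' ^ 2 ∂ν ≤ s₂) :
    ∫ x, ((∑ a, ∑ b, H (x.1 a) (x.2 b)) / (m : ℝ) ^ 2 - ∫ w, ∫ w', H w w' ∂ν ∂ν) ^ 2
      ∂((Measure.pi fun _ : Fin m => ν).prod (Measure.pi fun _ : Fin m => ν)) ≤
      2 * s₁ / m + s₂ / (m : ℝ) ^ 2 := by
  have hm' : (0 : ℝ) < m := by exact_mod_cast hm
  set θ : ℝ := ∫ w, ∫ w', H w w' ∂ν ∂ν with hθ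
  set μ : Measure (Fin m → E) := Measure.pi fun _ : Fin m => ν with hμ
  have hH1 : Measurable fun w => ∫ w', H w w' ∂ν :=
    hH.stronglyMeasurable.integral_prod_right.measurable
  have hH1' : Measurable fun w' => ∫ w, H w w' ∂ν :=
    hH.stronglyMeasurable.integral_prod_left.measurable
  have hK1 : ∀ w, |∫ w', H w w' ∂ν| ≤ K := fun w => abs_integral_le_of_abs_le (hK w)
  have hK1' : ∀ w', |∫ w, H w w' ∂ν| ≤ K := fun w' => abs_integral_le_of_abs_le fun w => hK w w'
  have hθK : |θ| ≤ K := abs_integral_le_of_abs_le hK1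
  have hHi : Integrable (Function.uncurry H) (ν.prod ν) :=
    integrable_of_abs_le hH fun p => hK p.1 p.2
  have hθ' : θ = ∫ w', ∫ w, H w w' ∂ν ∂ν := integral_integral_swap hHi
  set h : E → E → ℝ := fun w w' => H w w' - θ with hh
  have hhK : ∀ w w', |h w w'| ≤ 2 * K := fun w w' =>
    (abs_sub _ _).trans (by linarith [hK w w'])
  have hhm : Measurable (Function.uncurry h) := hH.sub_const θ
  have hHl : ∀ w', Measurable fun w => H w w' := fun w' => hH.of_uncurry_right
  have hHr : ∀ w, Measurable fun w' => H w w' := fun w => hH.of_uncurry_left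
  have hhl : ∀ w', Measurable fun w => h w w' := fun w' => hhm.of_uncurry_right
  have hhr : ∀ w, Measurable fun w' => h w w' := fun w => hhm.of_uncurry_left
  have hh1 : ∀ w, ∫ w', h w w' ∂ν = (∫ w', H w w' ∂ν) - θ := by
    intro w
    rw [integral_sub (integrable_of_abs_le (hHr w) (hK w)) (integrable_const _)]
    simp
  have hh1' : ∀ w', ∫ w, h w w' ∂ν = (∫ w, H w w' ∂ν) - θ := by
    intro w'
    rw [integral_sub (integrable_of_abs_le (hHl w') fun w => hK w w') (integrable_const _)]
    simp
  have hmean : ∀ (x : Fin m → E) (w' : E), |(∑ a, h (x a) w') / m| ≤ 2 * K := fun x w' =>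
    abs_sum_div_card_le hm fun a => hhK _ _
  have hmeas : Measurable fun p : (Fin m → E) × E => (∑ a, h (p.1 a) p.2) / (m : ℝ) := by
    refine (Finset.measurable_sum _ fun a _ => ?_).div_const _
    exact hhm.comp (f := fun p : (Fin m → E) × E => (p.1 a, p.2))
      (((measurable_pi_apply a).comp measurable_fst).prodMk measurable_snd)
  have hmeas2 : Measurable fun p : (Fin m → E) × (Fin m → E) =>
      (∑ b, (∑ a, h (p.1 a) (p.2 b)) / (m : ℝ)) / (m : ℝ) := by
    refine (Finset.measurable_sum _ fun b _ => ?_).div_const _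
    exact hmeas.comp (measurable_fst.prodMk ((measurable_pi_apply b).comp measurable_snd))
  have hrew : ∀ p : (Fin m → E) × (Fin m → E),
      (∑ a, ∑ b, H (p.1 a) (p.2 b)) / (m : ℝ) ^ 2 - θ =
        (∑ b, (∑ a, h (p.1 a) (p.2 b)) / (m : ℝ)) / (m : ℝ) := by
    intro p
    rw [Finset.sum_comm]
    simp only [hh, Finset.sum_sub_distrib, Finset.sum_const, Finset.card_univ, Fintype.card_fin,
      nsmul_eq_mul, ← Finset.sum_div]
    field_simp
  simp only [hrew]
  rw [integral_prod _ (integrable_sq_of_abs_le hmeas2 fun p =>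
    abs_sum_div_card_le hm fun b => hmean _ _)]
  have hM : Measurable fun x : Fin m → E => ∫ w', (∑ a, h (x a) w') / (m : ℝ) ∂ν :=
    hmeas.stronglyMeasurable.integral_prod_right.measurable
  have hMK : ∀ x : Fin m → E, |∫ w', (∑ a, h (x a) w') / (m : ℝ) ∂ν| ≤ 2 * K := fun x =>
    abs_integral_le_of_abs_le (hmean x)
  have hsqK : ∀ (x : Fin m → E) (w' : E), |((∑ a, h (x a) w') / (m : ℝ)) ^ 2| ≤ (2 * K) ^ 2 := by
    intro x w'
    rw [abs_pow]
    exact pow_le_pow_left₀ (abs_nonneg _) (hmean x w') 2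
  have hQ : Measurable fun x : Fin m → E => ∫ w', ((∑ a, h (x a) w') / (m : ℝ)) ^ 2 ∂ν :=
    (hmeas.pow_const 2).stronglyMeasurable.integral_prod_right.measurable
  have hQi : Integrable (fun x : Fin m → E => ∫ w', ((∑ a, h (x a) w') / (m : ℝ)) ^ 2 ∂ν) μ :=
    integrable_of_abs_le hQ fun x => abs_integral_le_of_abs_le (hsqK x)
  have hMi := integrable_sq_of_abs_le (μ := μ) hM hMK
  have step1 : ∫ x, ∫ y, ((∑ b, (∑ a, h (x a) (y b)) / (m : ℝ)) / (m : ℝ)) ^ 2 ∂μ ∂μ ≤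
      ∫ x, ((∫ w', (∑ a, h (x a) w') / (m : ℝ) ∂ν) ^ 2 +
        (∫ w', ((∑ a, h (x a) w') / (m : ℝ)) ^ 2 ∂ν) / m) ∂μ := by
    refine integral_mono ?_ (hMi.add (hQi.div_const _)) fun x => ?_
    · refine integrable_of_abs_le
        (hmeas2.pow_const 2).stronglyMeasurable.integral_prod_right.measurable
        (K := (2 * K) ^ 2) fun x => abs_integral_le_of_abs_le fun y => ?_
      rw [abs_pow]
      exact pow_le_pow_left₀ (abs_nonneg _) (abs_sum_div_card_le hm fun b => hmean _ _) 2
    · exact integral_sampleMean_sq_le ν hm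
        (hmeas.comp (measurable_const.prodMk measurable_id)) (hmean x)
  refine step1.trans ?_
  rw [integral_add hMi (hQi.div_const _), integral_div]
  -- The conditional mean given the first sample is itself a sample mean of the centred projections
  -- `∫ H w · - θ`.
  have hfirst : ∫ x, (∫ w', (∑ a, h (x a) w') / (m : ℝ) ∂ν) ^ 2 ∂μ ≤ s₁ / m := by
    have e : ∀ x : Fin m → E, ∫ w', (∑ a, h (x a) w') / (m : ℝ) ∂ν =
        (∑ a, ((∫ w', H (x a) w' ∂ν) - θ)) / (m : ℝ) := by
      intro x
      rw [integral_div, integral_finsetSum _ fun a _ => integrable_of_abs_le (hhr _) (hhK _)]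
      simp only [hh1]
    simp only [e]
    refine (integral_sampleMean_sq_le ν hm (hH1.sub_const θ) (K := 2 * K) fun w =>
      (abs_sub _ _).trans (by linarith [hK1 w])).trans ?_
    have z : ∫ w, ((∫ w', H w w' ∂ν) - θ) ∂ν = 0 := by
      rw [integral_sub (integrable_of_abs_le hH1 hK1) (integrable_const _)]
      simp [hθ]
    rw [z]
    have := (integral_sub_integral_sq_le (μ := ν) hH1 hK1).trans hs₁
    simp only [← hθ] at this
    have := div_le_div_of_nonneg_right this hm'.le
    simpa using this
  -- For fixed `w'` the average over the first sample has mean `∫ H · w' - θ`, whose square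
  -- integrates to at most `s₁`; its variance costs a further factor `1 / m`.
  have hsecond : ∫ x, ∫ w', ((∑ a, h (x a) w') / (m : ℝ)) ^ 2 ∂ν ∂μ ≤ s₁ + s₂ / m := by
    rw [integral_integral_swap (integrable_of_abs_le (hmeas.pow_const 2) fun p => hsqK p.1 p.2)]
    have hb : ∀ w', ∫ x, ((∑ a, h (x a) w') / (m : ℝ)) ^ 2 ∂μ ≤
        ((∫ w, H w w' ∂ν) - θ) ^ 2 + (∫ w, h w w' ^ 2 ∂ν) / m := by
      intro w'
      rw [← hh1']
      exact integral_sampleMean_sq_le ν hm (hhl w') fun w => hhK w w'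
    have hA : Integrable (fun w' => ((∫ w, H w w' ∂ν) - θ) ^ 2) ν :=
      integrable_sq_of_abs_le (hH1'.sub_const θ) (K := 2 * K) fun w =>
      (abs_sub _ _).trans (by linarith [hK1' w])
    have hB : Integrable (fun w' => ∫ w, h w w' ^ 2 ∂ν) ν := by
      refine integrable_of_abs_le
        (hhm.pow_const 2).stronglyMeasurable.integral_prod_left.measurable
        (K := (2 * K) ^ 2) fun w' => abs_integral_le_of_abs_le fun w => ?_
      rw [abs_pow]
      exact pow_le_pow_left₀ (abs_nonneg _) (hhK _ _) 2
    refine (integral_mono ?_ (hA.add (hB.div_const _)) hb).trans ?_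
    · exact integrable_of_abs_le
        (hmeas.pow_const 2).stronglyMeasurable.integral_prod_left.measurable
        (K := (2 * K) ^ 2) fun w' => abs_integral_le_of_abs_le fun x => hsqK x w'
    · simp only [Pi.add_apply]
      rw [integral_add hA (hB.div_const _), integral_div]
      have h1 : ∫ w', ((∫ w, H w w' ∂ν) - θ) ^ 2 ∂ν ≤ s₁ := by
        have := (integral_sub_integral_sq_le (μ := ν) hH1' hK1').trans hs₁'
        rwa [← hθ'] at this
      have h2 : ∫ w', ∫ w, h w w' ^ 2 ∂ν ∂ν ≤ s₂ := by
        -- Centring by the global mean `θ` need not lower the second moment for each `w'`. After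
        -- integration over `w'` the extra terms sum to `-θ²`.
        have e : ∀ w', ∫ w, h w w' ^ 2 ∂ν ≤ s₂ - 2 * θ * (∫ w, H w w' ∂ν) + θ ^ 2 := by
          intro w'
          have i1 := integrable_sq_of_abs_le (μ := ν) (hHl w') (fun w => hK w w')
          have i2 := integrable_of_abs_le (μ := ν) (hHl w') (fun w => hK w w')
          have : ∀ w, h w w' ^ 2 = H w w' ^ 2 - 2 * θ * H w w' + θ ^ 2 := fun w => by
            simp only [hh]; ring
          simp only [this]
          have i4 : Integrable (fun w => H w w' ^ 2 - 2 * θ * H w w') ν := i1.sub (i2.const_mul _)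
          rw [integral_add i4 (integrable_const _), integral_sub i1 (i2.const_mul _), integral_const_mul]
          have := hs₂ w'
          simp
          linarith
        have i3 : Integrable (fun w' => 2 * θ * ∫ w, H w w' ∂ν) ν :=
          (integrable_of_abs_le hH1' hK1').const_mul _
        have i4 : Integrable (fun w' => s₂ - 2 * θ * ∫ w, H w w' ∂ν) ν :=
          (integrable_const s₂).sub i3
        refine (integral_mono hB (i4.add (integrable_const (θ ^ 2))) e).trans ?_
        simp only [Pi.add_apply]
        rw [integral_add i4 (integrable_const _), integral_sub (integrable_const _) i3, integral_const_mul, ← hθ']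
        simp
        nlinarith [sq_nonneg θ]
      have := div_le_div_of_nonneg_right h2 hm'.le
      linarith
  have := div_le_div_of_nonneg_right hsecond hm'.le
  have e : (s₁ + s₂ / m) / (m : ℝ) = s₁ / m + s₂ / (m : ℝ) ^ 2 := by field_simp
  have e2 : 2 * s₁ / m = s₁ / m + s₁ / (m : ℝ) := by ring
  linarith

/-! ### Reduction of the estimator to two-sample statistics -/

/-- The preimage of a box is a box whose sides outside the range of `e` are the whole space, of mass
one. -/
theorem measurePreserving_comp_injective {ι κ Ω : Type*} [Fintype ι] [Fintype κ]
    [MeasurableSpace Ω] (P : Measure Ω) [IsProbabilityMeasure P] {e : ι → κ}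
    (he : Function.Injective e) :
    MeasurePreserving (fun (z : κ → Ω) i => z (e i)) (Measure.pi fun _ => P)
      (Measure.pi fun _ => P) := by
  have hm : Measurable (fun (z : κ → Ω) i => z (e i)) :=
    measurable_pi_lambda _ fun i => measurable_pi_apply _
  refine ⟨hm, (Measure.pi_eq fun s hs => ?_).symm⟩
  rw [Measure.map_apply hm (.univ_pi hs)]
  have : (fun (z : κ → Ω) i => z (e i)) ⁻¹' (Set.univ.pi s) =
      Set.univ.pi (Function.extend e s fun _ => Set.univ) := by
    ext z
    simp only [Set.mem_preimage, Set.mem_pi, Set.mem_univ, true_implies]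
    refine ⟨fun h k => ?_, fun h i => ?_⟩
    · by_cases hk : ∃ i, e i = k
      · obtain ⟨i, rfl⟩ := hk
        rw [he.extend_apply]
        exact h i
      · rw [Function.extend_apply' _ _ _ hk]
        trivial
    · simpa [he.extend_apply] using h (e i)
  rw [this, Measure.pi_pi]
  refine (Fintype.prod_of_injective e he _ _ (fun k hk => ?_) fun i => ?_).symm
  · rw [Function.extend_apply' _ _ _ hk]
    exact measure_univ
  · rw [he.extend_apply]

/-- The index set of two samples of `m` pairs. -/
abbrev TwoPairs (m : ℕ) : Type := (Fin m ⊕ Fin m) ⊕ (Fin m ⊕ Fin m)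

/-- The two samples of pairs extracted from a sample of observations. -/
def toPairs {Ω : Type*} {n m : ℕ} (e : TwoPairs m → Fin n) (z : Fin n → Ω) :
    (Fin m → Ω × Ω) × (Fin m → Ω × Ω) :=
  (fun a => (z (e (.inl (.inl a))), z (e (.inl (.inr a)))),
    fun b => (z (e (.inr (.inl b))), z (e (.inr (.inr b)))))

theorem measurePreserving_toPairs {Ω : Type*} [MeasurableSpace Ω] (P : Measure Ω)
    [IsProbabilityMeasure P] {n m : ℕ} {e : TwoPairs m → Fin n} (he : Function.Injective e) :
    MeasurePreserving (toPairs e : (Fin n → Ω) → _) (Measure.pi fun _ => P)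
      ((Measure.pi fun _ : Fin m => P.prod P).prod (Measure.pi fun _ : Fin m => P.prod P)) := by
  have h1 := measurePreserving_comp_injective P he
  have h2 := measurePreserving_sumPiEquivProdPi
    (X := fun _ : TwoPairs m => Ω) (fun _ => P)
  have h3 := measurePreserving_sumPiEquivProdPi (X := fun _ : Fin m ⊕ Fin m => Ω) (fun _ => P)
  have h4 := (measurePreserving_arrowProdEquivProdArrow Ω Ω (Fin m) (fun _ => P)
    (fun _ => P)).symm
  have h5 := h4.comp h3
  exact ((h5.prod h5).comp h2).comp h1

/-- The normalised sum of the interactions between two samples of pairs. -/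
def twoSampleStat {E : Type*} {m : ℕ} (H : E → E → ℝ) (x : (Fin m → E) × (Fin m → E)) : ℝ :=
  (∑ a, ∑ b, H (x.1 a) (x.2 b)) / (m : ℝ) ^ 2

theorem measurable_twoSampleStat {E : Type*} [MeasurableSpace E] {m : ℕ} {H : E → E → ℝ}
    (hH : Measurable (Function.uncurry H)) :
    Measurable (twoSampleStat H : (Fin m → E) × (Fin m → E) → ℝ) := by
  refine (Finset.measurable_sum _ fun a _ => Finset.measurable_sum _ fun b _ => ?_).div_const _
  exact hH.comp (f := fun p : (Fin m → E) × (Fin m → E) => (p.1 a, p.2 b)) (by fun_prop)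

theorem abs_twoSampleStat_le {E : Type*} {m : ℕ} (hm : 0 < m) {H : E → E → ℝ} {K : ℝ}
    (hK : ∀ w w', |H w w'| ≤ K) (x : (Fin m → E) × (Fin m → E)) : |twoSampleStat H x| ≤ K := by
  have : twoSampleStat H x = (∑ a, (∑ b, H (x.1 a) (x.2 b)) / (m : ℝ)) / m := by
    unfold twoSampleStat
    rw [← Finset.sum_div, div_div, sq]
  rw [this]
  exact abs_sum_div_card_le hm fun a => abs_sum_div_card_le hm fun b => hK _ _

/-- Each pair `(a, b)` involves four distinct observations, so averaging its interaction over
permutations already gives the statistic. The `m²` averages are thus equal, and so is their mean. -/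
theorem hsicStat_eq_sum_perm {p q n m : ℕ} (hm : 0 < m) (lam : Fin p → ℝ) (mu : Fin q → ℝ)
    {e : TwoPairs m → Fin n} (he : Function.Injective e) (z : Fin n → Obs p q) :
    hsicStat n lam mu z = (∑ σ : Equiv.Perm (Fin n), twoSampleStat
      (pairKernel (gaussianKernel lam) (gaussianKernel mu)) (toPairs (σ ∘ e) z)) /
        (n.factorial : ℝ) := by
  have hm' : (m : ℝ) ≠ 0 := by exact_mod_cast hm.ne'
  have key : ∀ a b : Fin m, ∑ σ : Equiv.Perm (Fin n),
      pairKernel (gaussianKernel lam) (gaussianKernel mu)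
        ((toPairs (σ ∘ e) z).1 a) ((toPairs (σ ∘ e) z).2 b) =
      n.factorial * hsicStat n lam mu z := by
    intro a b
    rw [mul_comm, ← div_eq_iff (by positivity)]
    exact sum_perm_pairKernel lam mu z (he.ne (by simp)) (he.ne (by simp)) (he.ne (by simp))
      (he.ne (by simp)) (he.ne (by simp)) (he.ne (by simp))
  unfold twoSampleStat
  rw [← Finset.sum_div, Finset.sum_comm]
  have : ∀ a, ∑ σ : Equiv.Perm (Fin n), ∑ b, pairKernel (gaussianKernel lam) (gaussianKernel mu)
        ((toPairs (σ ∘ e) z).1 a) ((toPairs (σ ∘ e) z).2 b) =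
      m * (n.factorial * hsicStat n lam mu z) := by
    intro a
    rw [Finset.sum_comm]
    simp [key]
  simp only [this]
  have hn : (n.factorial : ℝ) ≠ 0 := by positivity
  simp
  field_simp

theorem measurable_pairKernel {X Y : Type*} [MeasurableSpace X] [MeasurableSpace Y]
    {k : X → X → ℝ} {l : Y → Y → ℝ} (hk : Measurable (Function.uncurry k))
    (hl : Measurable (Function.uncurry l)) : Measurable (Function.uncurry (pairKernel k l)) := by
  have hk' : ∀ {f g : ((X × Y) × (X × Y)) × ((X × Y) × (X × Y)) → X}, Measurable f →
      Measurable g → Measurable fun p => k (f p) (g p) := fun hf hg => hk.comp (hf.prodMk hg)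
  have hl' : ∀ {f g : ((X × Y) × (X × Y)) × ((X × Y) × (X × Y)) → Y}, Measurable f →
      Measurable g → Measurable fun p => l (f p) (g p) := fun hf hg => hl.comp (hf.prodMk hg)
  refine ((((hk' ?_ ?_).sub (hk' ?_ ?_)).sub (hk' ?_ ?_)).add (hk' ?_ ?_)).mul
    ((((hl' ?_ ?_).sub (hl' ?_ ?_)).sub (hl' ?_ ?_)).add (hl' ?_ ?_)) |>.const_mul (1 / 4) <;>
  fun_prop

/-- The square of an average is at most the average of the squares. Every permuted two-sample
statistic has the same law, because composing an injection with a permutation leaves it injective,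
so a single two-sample bound suffices. -/
theorem integral_hsicStat_sub_sq_le {p q n m : ℕ} (hm : 0 < m) (hmn : 4 * m ≤ n)
    (lam : Fin p → ℝ) (mu : Fin q → ℝ) (P : Measure (Obs p q)) [IsProbabilityMeasure P]
    {K : ℝ} (hH : Measurable (Function.uncurry
      (pairKernel (gaussianKernel lam) (gaussianKernel mu))))
    (hK : ∀ w w', |pairKernel (gaussianKernel lam) (gaussianKernel mu) w w'| ≤ K)
    {s₁ s₂ θ : ℝ} (hθ : ∫ w, ∫ w', pairKernel (gaussianKernel lam) (gaussianKernel mu) w w'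
      ∂(P.prod P) ∂(P.prod P) = θ)
    (hs₁ : ∫ w, (∫ w', pairKernel (gaussianKernel lam) (gaussianKernel mu) w w'
      ∂(P.prod P)) ^ 2 ∂(P.prod P) ≤ s₁)
    (hs₂ : ∀ w, ∫ w', pairKernel (gaussianKernel lam) (gaussianKernel mu) w w' ^ 2
      ∂(P.prod P) ≤ s₂) :
    Measurable (hsicStat n lam mu : (Fin n → Obs p q) → ℝ) ∧
    (∀ z : Fin n → Obs p q, |hsicStat n lam mu z| ≤ K) ∧
    ∫ z, (hsicStat n lam mu z - θ) ^ 2 ∂(Measure.pi fun _ : Fin n => P) ≤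
      2 * s₁ / m + s₂ / (m : ℝ) ^ 2 := by
  set H := pairKernel (gaussianKernel lam) (gaussianKernel mu) with hHdef
  have hcomm : ∀ w w', H w w' = H w' w :=
    pairKernel_comm (gaussianKernel_comm lam) (gaussianKernel_comm mu)
  -- Two samples of `m` pairs use `4 * m` observations.
  obtain ⟨e⟩ : Nonempty (TwoPairs m ↪ Fin n) :=
    Function.Embedding.nonempty_of_card_le (by simp; omega)
  have hσ : ∀ σ : Equiv.Perm (Fin n), Function.Injective (σ ∘ e) := fun σ =>
    σ.injective.comp e.injective
  have hmp := fun σ => measurePreserving_toPairs P (hσ σ)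
  have hrep := hsicStat_eq_sum_perm hm lam mu e.injective
  simp only [← hHdef] at hrep
  have hTm := measurable_twoSampleStat (m := m) hH
  have hTσ : ∀ σ : Equiv.Perm (Fin n), Measurable fun z : Fin n → Obs p q =>
    twoSampleStat H (toPairs (σ ∘ e) z) := fun σ => hTm.comp (hmp σ).measurable
  have hfac : (0 : ℝ) < n.factorial := by positivity
  have hbd : ∀ σ : Equiv.Perm (Fin n),
      ∫ z, (twoSampleStat H (toPairs (σ ∘ e) z) - θ) ^ 2 ∂(Measure.pi fun _ : Fin n => P) ≤
        2 * s₁ / m + s₂ / (m : ℝ) ^ 2 := by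
    intro σ
    have h1 := integral_twoSample_sq_le (P.prod P) hm hH hK (s₁ := s₁) (s₂ := s₂) hs₁
      (by simpa only [hcomm] using hs₁) (by simpa only [hcomm] using hs₂)
    rw [hθ, ← (hmp σ).map_eq, integral_map (hmp σ).measurable.aemeasurable] at h1
    · exact h1
    · exact ((hTm.sub_const θ).pow_const 2).aestronglyMeasurable
  have hmeas : Measurable (hsicStat n lam mu : (Fin n → Obs p q) → ℝ) := by
    simp only [funext hrep]
    exact (Finset.measurable_sum _ fun σ _ => hTσ σ).div_const _
  refine ⟨hmeas, fun z => ?_, ?_⟩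
  · rw [hrep, abs_div, abs_of_pos hfac, div_le_iff₀ hfac]
    refine (Finset.abs_sum_le_sum_abs _ _).trans ?_
    refine (Finset.sum_le_sum fun σ _ => abs_twoSampleStat_le hm hK _).trans ?_
    simp [Fintype.card_perm, mul_comm]
  · have hint : ∀ σ : Equiv.Perm (Fin n), Integrable (fun z : Fin n → Obs p q =>
        (twoSampleStat H (toPairs (σ ∘ e) z) - θ) ^ 2) (Measure.pi fun _ : Fin n => P) :=
      fun σ => integrable_sq_of_abs_le ((hTσ σ).sub_const θ) (K := K + |θ|) fun z =>
        (abs_sub _ _).trans (by linarith [abs_twoSampleStat_le hm hK (toPairs (σ ∘ e) z)])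
    have hpt : ∀ z : Fin n → Obs p q, (hsicStat n lam mu z - θ) ^ 2 ≤
        (∑ σ : Equiv.Perm (Fin n), (twoSampleStat H (toPairs (σ ∘ e) z) - θ) ^ 2) /
          n.factorial := by
      intro z
      have h1 : hsicStat n lam mu z - θ =
          (∑ σ : Equiv.Perm (Fin n), (twoSampleStat H (toPairs (σ ∘ e) z) - θ)) /
            n.factorial := by
        rw [hrep, Finset.sum_sub_distrib]
        simp [Fintype.card_perm]
        field_simp
      rw [h1, div_pow, div_le_div_iff₀ (by positivity) hfac]
      have h2 := sq_sum_le_card_mul_sum_sq (s := (Finset.univ : Finset (Equiv.Perm (Fin n))))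
        (f := fun σ => twoSampleStat H (toPairs (σ ∘ e) z) - θ)
      simp only [Finset.card_univ, Fintype.card_perm, Fintype.card_fin] at h2
      nlinarith
    refine (integral_mono_of_nonneg (ae_of_all _ fun z => sq_nonneg _)
      ((integrable_finsetSum _ fun σ _ => hint σ).div_const _) (ae_of_all _ hpt)).trans ?_
    rw [integral_div, integral_finsetSum _ fun σ _ => hint σ, div_le_iff₀ hfac]
    refine (Finset.sum_le_sum fun σ _ => hbd σ).trans ?_
    simp only [Finset.sum_const, Finset.card_univ, Fintype.card_perm, Fintype.card_fin,
      nsmul_eq_mul]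
    rw [mul_comm]

/-! ### Mixed differences of a function of two components -/

section MixedDiff

variable {X Y : Type*}

/-- The mixed difference of a function of two components over a pair of observations. -/
def mixedDiff (F : X × Y → ℝ) (w : (X × Y) × (X × Y)) : ℝ :=
  F w.1 - F (w.1.1, w.2.2) - F (w.2.1, w.1.2) + F w.2

/-- With one pair frozen, the interaction is a mixed difference in the other, so its moments reduce
to those of `mixedDiff`. -/
theorem pairKernel_eq_mixedDiff_right (k : X → X → ℝ) (l : Y → Y → ℝ) (w w' : (X × Y) × (X × Y)) :
    pairKernel k l w w' = 1 / 4 *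
      mixedDiff (fun z' => (k w.1.1 z'.1 - k w.2.1 z'.1) * (l w.1.2 z'.2 - l w.2.2 z'.2)) w' := by
  unfold pairKernel mixedDiff
  ring

theorem abs_mixedDiff_le {F : X × Y → ℝ} {K : ℝ} (hK : ∀ z, |F z| ≤ K)
    (w : (X × Y) × (X × Y)) : |mixedDiff F w| ≤ 4 * K := by
  unfold mixedDiff
  have h1 := abs_le.1 (hK w.1)
  have h2 := abs_le.1 (hK (w.1.1, w.2.2))
  have h3 := abs_le.1 (hK (w.2.1, w.1.2))
  have h4 := abs_le.1 (hK w.2)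
  rw [abs_le]
  constructor <;> linarith

variable [MeasurableSpace X] [MeasurableSpace Y]

/-- The product of the two marginals of a measure. -/
def prodMarginals (P : Measure (X × Y)) : Measure (X × Y) :=
  (P.map Prod.fst).prod (P.map Prod.snd)

instance (P : Measure (X × Y)) [IsProbabilityMeasure P] :
    IsProbabilityMeasure (prodMarginals P) := by
  have := Measure.isProbabilityMeasure_map (μ := P) measurable_fst.aemeasurable
  have := Measure.isProbabilityMeasure_map (μ := P) measurable_snd.aemeasurable
  unfold prodMarginals
  infer_instance

/-- The two components come from different, independent observations. This is how the product of the
marginals enters without being sampled. -/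
theorem measurePreserving_recombine (P : Measure (X × Y)) [IsProbabilityMeasure P] :
    MeasurePreserving (fun w : (X × Y) × (X × Y) => (w.1.1, w.2.2)) (P.prod P)
      (prodMarginals P) :=
  ⟨by fun_prop, (Measure.map_prod_map P P measurable_fst measurable_snd).symm⟩

theorem measurePreserving_recombine_swap (P : Measure (X × Y)) [IsProbabilityMeasure P] :
    MeasurePreserving (fun w : (X × Y) × (X × Y) => (w.2.1, w.1.2)) (P.prod P)
      (prodMarginals P) :=
  (measurePreserving_recombine P).comp Measure.measurePreserving_swap

theorem integral_comp_of_measurePreserving {Ω Ω' : Type*} [MeasurableSpace Ω]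
    [MeasurableSpace Ω'] {μ : Measure Ω} {μ' : Measure Ω'} {T : Ω → Ω'}
    (hT : MeasurePreserving T μ μ') {φ : Ω' → ℝ} (hφ : Measurable φ) :
    ∫ ω, φ (T ω) ∂μ = ∫ ω, φ ω ∂μ' := by
  rw [← hT.map_eq, integral_map hT.measurable.aemeasurable hφ.aestronglyMeasurable]

/-- The value `ε = -1` gives the mean of the mixed difference, and `ε = 1`, applied to `F ^ 2`, its
second moment. -/
theorem integral_recombine_add (P : Measure (X × Y)) [IsProbabilityMeasure P] {F : X × Y → ℝ}
    (hF : Measurable F) {K : ℝ} (hK : ∀ z, |F z| ≤ K) (ε : ℝ) :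
    ∫ w, (F w.1 + ε * F (w.1.1, w.2.2) + ε * F (w.2.1, w.1.2) + F w.2) ∂(P.prod P) =
      2 * (∫ z, F z ∂P + ε * ∫ z, F z ∂(prodMarginals P)) := by
  have m1 : Measurable fun w : (X × Y) × (X × Y) => F w.1 := by fun_prop
  have m2 : Measurable fun w : (X × Y) × (X × Y) => F (w.1.1, w.2.2) := by fun_prop
  have m3 : Measurable fun w : (X × Y) × (X × Y) => F (w.2.1, w.1.2) := by fun_prop
  have m4 : Measurable fun w : (X × Y) × (X × Y) => F w.2 := by fun_prop
  have i1 := integrable_of_abs_le (μ := P.prod P) m1 fun w => hK _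
  have i2 := (integrable_of_abs_le (μ := P.prod P) m2 fun w => hK _).const_mul ε
  have i3 := (integrable_of_abs_le (μ := P.prod P) m3 fun w => hK _).const_mul ε
  have i4 := integrable_of_abs_le (μ := P.prod P) m4 fun w => hK _
  have i12 : Integrable (fun w : (X × Y) × (X × Y) => F w.1 + ε * F (w.1.1, w.2.2))
    (P.prod P) := i1.add i2
  have i123 : Integrable (fun w : (X × Y) × (X × Y) =>
    F w.1 + ε * F (w.1.1, w.2.2) + ε * F (w.2.1, w.1.2)) (P.prod P) := i12.add i3
  rw [integral_add i123 i4, integral_add i12 i3, integral_add i1 i2, integral_const_mul,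
    integral_const_mul, integral_comp_of_measurePreserving (measurePreserving_recombine P) hF,
    integral_comp_of_measurePreserving (measurePreserving_recombine_swap P) hF,
    integral_comp_of_measurePreserving (measurePreserving_fst (μ := P) (ν := P)) hF,
    integral_comp_of_measurePreserving (measurePreserving_snd (μ := P) (ν := P)) hF]
  ring

theorem integral_mixedDiff (P : Measure (X × Y)) [IsProbabilityMeasure P] {F : X × Y → ℝ}
    (hF : Measurable F) {K : ℝ} (hK : ∀ z, |F z| ≤ K) :
    ∫ w, mixedDiff F w ∂(P.prod P) = 2 * (∫ z, F z ∂P - ∫ z, F z ∂(prodMarginals P)) := by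
  have h := integral_recombine_add P hF hK (-1)
  have e : ∀ w, mixedDiff F w =
      F w.1 + -1 * F (w.1.1, w.2.2) + -1 * F (w.2.1, w.1.2) + F w.2 := by
    intro w; unfold mixedDiff; ring
  simp only [e, h]
  ring

theorem integral_mixedDiff_sq_le (P : Measure (X × Y)) [IsProbabilityMeasure P] {F : X × Y → ℝ}
    (hF : Measurable F) {K : ℝ} (hK : ∀ z, |F z| ≤ K) :
    ∫ w, mixedDiff F w ^ 2 ∂(P.prod P) ≤
      8 * (∫ z, F z ^ 2 ∂P + ∫ z, F z ^ 2 ∂(prodMarginals P)) := by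
  have hK2 : ∀ z, |F z ^ 2| ≤ K ^ 2 := fun z => by
    rw [abs_pow]
    exact pow_le_pow_left₀ (abs_nonneg _) (hK z) 2
  have hF2 : Measurable fun z => F z ^ 2 := hF.pow_const 2
  have h := integral_recombine_add P hF2 hK2 1
  have i : Integrable (fun w : (X × Y) × (X × Y) => 4 * (F w.1 ^ 2 + 1 * F (w.1.1, w.2.2) ^ 2 +
      1 * F (w.2.1, w.1.2) ^ 2 + F w.2 ^ 2)) (P.prod P) := by
    refine integrable_of_abs_le (by fun_prop) (K := 16 * K ^ 2) fun w => ?_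
    have h1 := abs_le.1 (hK2 w.1)
    have h2 := abs_le.1 (hK2 (w.1.1, w.2.2))
    have h3 := abs_le.1 (hK2 (w.2.1, w.1.2))
    have h4 := abs_le.1 (hK2 w.2)
    rw [abs_le]
    constructor <;> linarith
  have hle : ∀ w : (X × Y) × (X × Y), mixedDiff F w ^ 2 ≤ 4 * (F w.1 ^ 2 +
      1 * F (w.1.1, w.2.2) ^ 2 + 1 * F (w.2.1, w.1.2) ^ 2 + F w.2 ^ 2) := by
    intro w
    unfold mixedDiff
    generalize F w.1 = a, F (w.1.1, w.2.2) = b, F (w.2.1, w.1.2) = c, F w.2 = d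
    -- Lagrange's identity: the gap in the Cauchy-Schwarz inequality for `(a, -b, -c, d)` against
    -- `(1, 1, 1, 1)` is the sum of these six squares.
    nlinarith [sq_nonneg (a + b), sq_nonneg (a + c), sq_nonneg (a - d), sq_nonneg (b - c),
      sq_nonneg (b + d), sq_nonneg (c + d)]
  refine (integral_mono_of_nonneg (ae_of_all _ fun w => sq_nonneg _) i (ae_of_all _ hle)).trans ?_
  rw [integral_const_mul, h]
  apply le_of_eq
  ring

/-! ### First two moments of the pair kernel -/

variable {k : X → X → ℝ} {l : Y → Y → ℝ}

/-- The signed potential of `P - P₁ ⊗ P₂` for the product kernel. -/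
def dependencePotential (k : X → X → ℝ) (l : Y → Y → ℝ) (P : Measure (X × Y)) (z : X × Y) : ℝ :=
  ∫ z', k z.1 z'.1 * l z.2 z'.2 ∂P - ∫ z', k z.1 z'.1 * l z.2 z'.2 ∂(prodMarginals P)

theorem integral_sub_mul_sub {μ : Measure (X × Y)} [IsProbabilityMeasure μ]
    (hk : Measurable (Function.uncurry k)) (hl : Measurable (Function.uncurry l))
    {K : ℝ} (hK : ∀ x x' y y', |k x x' * l y y'| ≤ K) (w : (X × Y) × (X × Y)) :
    ∫ z', (k w.1.1 z'.1 - k w.2.1 z'.1) * (l w.1.2 z'.2 - l w.2.2 z'.2) ∂μ =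
      mixedDiff (fun z => ∫ z', k z.1 z'.1 * l z.2 z'.2 ∂μ) w := by
  have i : ∀ x y, Integrable (fun z' : X × Y => k x z'.1 * l y z'.2) μ := by
    intro x y
    refine integrable_of_abs_le (Measurable.mul ?_ ?_) fun z' => hK _ _ _ _
    · exact hk.comp (f := fun z' : X × Y => (x, z'.1)) (by fun_prop)
    · exact hl.comp (f := fun z' : X × Y => (y, z'.2)) (by fun_prop)
  have e : ∀ z' : X × Y, (k w.1.1 z'.1 - k w.2.1 z'.1) * (l w.1.2 z'.2 - l w.2.2 z'.2) =
      k w.1.1 z'.1 * l w.1.2 z'.2 - k w.1.1 z'.1 * l w.2.2 z'.2 - k w.2.1 z'.1 * l w.1.2 z'.2 +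
        k w.2.1 z'.1 * l w.2.2 z'.2 := fun z' => by ring
  have i2 : Integrable (fun z' : X × Y => k w.1.1 z'.1 * l w.1.2 z'.2 -
      k w.1.1 z'.1 * l w.2.2 z'.2) μ := (i _ _).sub (i _ _)
  have i3 : Integrable (fun z' : X × Y => k w.1.1 z'.1 * l w.1.2 z'.2 -
      k w.1.1 z'.1 * l w.2.2 z'.2 - k w.2.1 z'.1 * l w.1.2 z'.2) μ := i2.sub (i _ _)
  simp only [e]
  rw [integral_add i3 (i _ _), integral_sub i2 (i _ _), integral_sub (i _ _) (i _ _)]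
  rfl

theorem measurable_integral_kernel (μ : Measure (X × Y)) [IsProbabilityMeasure μ]
    (hk : Measurable (Function.uncurry k)) (hl : Measurable (Function.uncurry l)) :
    Measurable fun z : X × Y => ∫ z', k z.1 z'.1 * l z.2 z'.2 ∂μ := by
  have : Measurable (Function.uncurry fun z z' : X × Y => k z.1 z'.1 * l z.2 z'.2) := by
    refine Measurable.mul ?_ ?_
    · exact hk.comp (f := fun p : (X × Y) × (X × Y) => (p.1.1, p.2.1)) (by fun_prop)
    · exact hl.comp (f := fun p : (X × Y) × (X × Y) => (p.1.2, p.2.2)) (by fun_prop)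
  exact this.stronglyMeasurable.integral_prod_right.measurable

theorem measurable_dependencePotential (P : Measure (X × Y)) [IsProbabilityMeasure P]
    (hk : Measurable (Function.uncurry k)) (hl : Measurable (Function.uncurry l)) :
    Measurable (dependencePotential k l P) :=
  (measurable_integral_kernel P hk hl).sub (measurable_integral_kernel _ hk hl)

theorem abs_dependencePotential_le (P : Measure (X × Y)) [IsProbabilityMeasure P]
    {K : ℝ} (hK : ∀ x x' y y', |k x x' * l y y'| ≤ K) (z : X × Y) :
    |dependencePotential k l P z| ≤ 2 * K := by
  have h1 := abs_integral_le_of_abs_le (μ := P)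
    fun z' : X × Y => hK z.1 z'.1 z.2 z'.2
  have h2 := abs_integral_le_of_abs_le (μ := prodMarginals P)
    fun z' : X × Y => hK z.1 z'.1 z.2 z'.2
  exact (abs_sub _ _).trans (by linarith)

/-- Averaging the mixed difference in `w'` gives twice the integral against `P - P₁ ⊗ P₂`, and the
remaining differences in `w` pass to the potential; `1 / 2` is `1 / 4 * 2`. -/
theorem integral_pairKernel (P : Measure (X × Y)) [IsProbabilityMeasure P]
    (hk : Measurable (Function.uncurry k)) (hl : Measurable (Function.uncurry l))
    {K : ℝ} (hK : ∀ x x' y y', |k x x' * l y y'| ≤ K) (w : (X × Y) × (X × Y)) :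
    ∫ w', pairKernel k l w w' ∂(P.prod P) = 1 / 2 * mixedDiff (dependencePotential k l P) w := by
  simp only [pairKernel_eq_mixedDiff_right]
  rw [integral_const_mul, integral_mixedDiff P (K := 4 * K), integral_sub_mul_sub hk hl hK,
    integral_sub_mul_sub hk hl hK]
  · unfold mixedDiff dependencePotential
    ring
  · refine Measurable.mul (Measurable.sub ?_ ?_) (Measurable.sub ?_ ?_)
    · exact hk.comp (f := fun z' : X × Y => (w.1.1, z'.1)) (by fun_prop)
    · exact hk.comp (f := fun z' : X × Y => (w.2.1, z'.1)) (by fun_prop)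
    · exact hl.comp (f := fun z' : X × Y => (w.1.2, z'.2)) (by fun_prop)
    · exact hl.comp (f := fun z' : X × Y => (w.2.2, z'.2)) (by fun_prop)
  · intro z'
    have h1 := abs_le.1 (hK w.1.1 z'.1 w.1.2 z'.2)
    have h2 := abs_le.1 (hK w.1.1 z'.1 w.2.2 z'.2)
    have h3 := abs_le.1 (hK w.2.1 z'.1 w.1.2 z'.2)
    have h4 := abs_le.1 (hK w.2.1 z'.1 w.2.2 z'.2)
    rw [abs_le]
    constructor <;> nlinarith

/-- Drop `-2ab` and replace one factor of each square by `B`. This trades a square for a first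
power, so that squared kernels and squared densities are controlled by their integrals. -/
theorem sq_sub_le_mul_add {a b B : ℝ} (ha : 0 ≤ a) (hb : 0 ≤ b) (haB : a ≤ B) (hbB : b ≤ B) :
    (a - b) ^ 2 ≤ B * (a + b) := by
  nlinarith [mul_nonneg ha hb, mul_le_mul_of_nonneg_right haB ha,
    mul_le_mul_of_nonneg_right hbB hb]

/-- One factor of each squared kernel is bounded by its supremum and the other integrated against
the law, so that `B₁ * B₂` appears only to the first power. The constant is `(1 / 16) * 8 * (4 + 4)
= 4`. -/
theorem integral_pairKernel_sq_le (P : Measure (X × Y)) [IsProbabilityMeasure P]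
    (hk : Measurable (Function.uncurry k)) (hl : Measurable (Function.uncurry l))
    (hk0 : ∀ x x', 0 ≤ k x x') (hl0 : ∀ y y', 0 ≤ l y y') {B₁ B₂ : ℝ}
    (hkB : ∀ x x', k x x' ≤ B₁) (hlB : ∀ y y', l y y' ≤ B₂) {c : ℝ}
    (hc : ∀ x y, ∫ z', k x z'.1 * l y z'.2 ∂P ≤ c)
    (hc' : ∀ x y, ∫ z', k x z'.1 * l y z'.2 ∂(prodMarginals P) ≤ c) (w : (X × Y) × (X × Y)) :
    ∫ w', pairKernel k l w w' ^ 2 ∂(P.prod P) ≤ 4 * c * (B₁ * B₂) := by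
  have hB₁ : 0 ≤ B₁ := (hk0 w.1.1 w.1.1).trans (hkB _ _)
  have hB₂ : 0 ≤ B₂ := (hl0 w.1.2 w.1.2).trans (hlB _ _)
  have hk' : ∀ x, Measurable fun z' : X × Y => k x z'.1 := fun x =>
    hk.comp (f := fun z' : X × Y => (x, z'.1)) (by fun_prop)
  have hl' : ∀ y, Measurable fun z' : X × Y => l y z'.2 := fun y =>
    hl.comp (f := fun z' : X × Y => (y, z'.2)) (by fun_prop)
  have hKa : ∀ x x' y y', |k x x' * l y y'| ≤ B₁ * B₂ := fun x x' y y' => by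
    rw [abs_of_nonneg (mul_nonneg (hk0 _ _) (hl0 _ _))]
    exact mul_le_mul (hkB _ _) (hlB _ _) (hl0 _ _) hB₁
  set F : X × Y → ℝ := fun z' =>
    (k w.1.1 z'.1 - k w.2.1 z'.1) * (l w.1.2 z'.2 - l w.2.2 z'.2) with hF
  have hFm : Measurable F := ((hk' _).sub (hk' _)).mul ((hl' _).sub (hl' _))
  have hFK : ∀ z, |F z| ≤ B₁ * B₂ := fun z => by
    rw [hF, abs_mul]
    refine mul_le_mul ?_ ?_ (abs_nonneg _) hB₁
    · exact abs_sub_le_of_nonneg_of_le (hk0 _ _) (hkB _ _) (hk0 _ _) (hkB _ _)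
    · exact abs_sub_le_of_nonneg_of_le (hl0 _ _) (hlB _ _) (hl0 _ _) (hlB _ _)
  have hFsq : ∀ (μ : Measure (X × Y)) [IsProbabilityMeasure μ],
      (∀ x y, ∫ z', k x z'.1 * l y z'.2 ∂μ ≤ c) → ∫ z', F z' ^ 2 ∂μ ≤ 4 * c * (B₁ * B₂) := by
    intro μ _ hμ
    have i : ∀ x y, Integrable (fun z' : X × Y => k x z'.1 * l y z'.2) μ := fun x y =>
      integrable_of_abs_le ((hk' x).mul (hl' y)) fun z' => hKa _ _ _ _
    have i2 : Integrable (fun z' : X × Y => k w.1.1 z'.1 * l w.1.2 z'.2 +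
        k w.1.1 z'.1 * l w.2.2 z'.2) μ := (i _ _).add (i _ _)
    have i3 : Integrable (fun z' : X × Y => k w.1.1 z'.1 * l w.1.2 z'.2 +
        k w.1.1 z'.1 * l w.2.2 z'.2 + k w.2.1 z'.1 * l w.1.2 z'.2) μ := i2.add (i _ _)
    have i4 : Integrable (fun z' : X × Y => k w.1.1 z'.1 * l w.1.2 z'.2 +
        k w.1.1 z'.1 * l w.2.2 z'.2 + k w.2.1 z'.1 * l w.1.2 z'.2 +
        k w.2.1 z'.1 * l w.2.2 z'.2) μ := i3.add (i _ _)
    have hle : ∀ z', F z' ^ 2 ≤ (B₁ * B₂) * (k w.1.1 z'.1 * l w.1.2 z'.2 +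
        k w.1.1 z'.1 * l w.2.2 z'.2 + k w.2.1 z'.1 * l w.1.2 z'.2 +
        k w.2.1 z'.1 * l w.2.2 z'.2) := by
      intro z'
      have h1 := sq_sub_le_mul_add (hk0 w.1.1 z'.1) (hk0 w.2.1 z'.1) (hkB _ _) (hkB _ _)
      have h2 := sq_sub_le_mul_add (hl0 w.1.2 z'.2) (hl0 w.2.2 z'.2) (hlB _ _) (hlB _ _)
      rw [hF]
      simp only [mul_pow]
      refine (mul_le_mul h1 h2 (sq_nonneg _) ((sq_nonneg _).trans h1)).trans (le_of_eq ?_)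
      ring
    refine (integral_mono_of_nonneg (ae_of_all _ fun z => sq_nonneg _) (i4.const_mul _)
      (ae_of_all _ hle)).trans ?_
    rw [integral_const_mul, integral_add i3 (i _ _), integral_add i2 (i _ _),
      integral_add (i _ _) (i _ _)]
    have := mul_le_mul_of_nonneg_left (add_le_add (add_le_add (add_le_add (hμ w.1.1 w.1.2)
      (hμ w.1.1 w.2.2)) (hμ w.2.1 w.1.2)) (hμ w.2.1 w.2.2)) (mul_nonneg hB₁ hB₂)
    linarith
  have h := integral_mixedDiff_sq_le P hFm hFK
  simp only [pairKernel_eq_mixedDiff_right, mul_pow]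
  rw [integral_const_mul]
  have h1 := hFsq P hc
  have h2 := hFsq (prodMarginals P) hc'
  linarith

end MixedDiff

/-! ### Mean and variance of the estimator -/

/-- The mean of the estimator: the energy of `P - P₁ ⊗ P₂` for the product kernel. -/
def dependenceEnergy {X Y : Type*} [MeasurableSpace X] [MeasurableSpace Y] (k : X → X → ℝ)
    (l : Y → Y → ℝ) (P : Measure (X × Y)) : ℝ :=
  ∫ z, dependencePotential k l P z ∂P - ∫ z, dependencePotential k l P z ∂(prodMarginals P)

theorem variance_hsicStat_le {p q n m : ℕ} (hm : 0 < m) (hmn : 4 * m ≤ n)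
    (lam : Fin p → ℝ) (mu : Fin q → ℝ) (P : Measure (Obs p q)) [IsProbabilityMeasure P]
    (hk : Measurable (Function.uncurry (gaussianKernel lam)))
    (hl : Measurable (Function.uncurry (gaussianKernel mu)))
    (hk0 : ∀ x x', 0 ≤ gaussianKernel lam x x') (hl0 : ∀ y y', 0 ≤ gaussianKernel mu y y')
    {B₁ B₂ : ℝ} (hkB : ∀ x x', gaussianKernel lam x x' ≤ B₁)
    (hlB : ∀ y y', gaussianKernel mu y y' ≤ B₂) {c : ℝ}
    (hc : ∀ x y, ∫ z', gaussianKernel lam x z'.1 * gaussianKernel mu y z'.2 ∂P ≤ c)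
    (hc' : ∀ x y, ∫ z', gaussianKernel lam x z'.1 * gaussianKernel mu y z'.2
      ∂(prodMarginals P) ≤ c) :
    Measurable (hsicStat n lam mu : (Fin n → Obs p q) → ℝ) ∧
    (∀ z : Fin n → Obs p q, |hsicStat n lam mu z| ≤ 4 * (B₁ * B₂)) ∧
    ∫ z, (hsicStat n lam mu z -
        dependenceEnergy (gaussianKernel lam) (gaussianKernel mu) P) ^ 2
        ∂(Measure.pi fun _ : Fin n => P) ≤
      4 * (∫ z, dependencePotential (gaussianKernel lam) (gaussianKernel mu) P z ^ 2 ∂P +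
        ∫ z, dependencePotential (gaussianKernel lam) (gaussianKernel mu) P z ^ 2
          ∂(prodMarginals P)) / m + 4 * c * (B₁ * B₂) / (m : ℝ) ^ 2 := by
  set k := gaussianKernel lam with hkdef
  set l := gaussianKernel mu with hldef
  have hB₁ : 0 ≤ B₁ := (hk0 0 0).trans (hkB _ _)
  have hKa : ∀ x x' y y', |k x x' * l y y'| ≤ B₁ * B₂ := fun x x' y y' => by
    rw [abs_of_nonneg (mul_nonneg (hk0 _ _) (hl0 _ _))]
    exact mul_le_mul (hkB _ _) (hlB _ _) (hl0 _ _) hB₁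
  have hGm := measurable_dependencePotential P hk hl
  have hGK := abs_dependencePotential_le P hKa
  -- The projection is half a mixed difference, so `s₁` carries `(1 / 4) * 8 = 2`. The uniform bound
  -- `4 * (B₁ * B₂)` is not sharp; it serves integrability only.
  have hmain := integral_hsicStat_sub_sq_le hm hmn lam mu P (measurable_pairKernel hk hl)
    (K := 4 * (B₁ * B₂)) ?_ (θ := dependenceEnergy k l P)
    (s₁ := 2 * (∫ z, dependencePotential k l P z ^ 2 ∂P +
        ∫ z, dependencePotential k l P z ^ 2 ∂(prodMarginals P)))
    (s₂ := 4 * c * (B₁ * B₂)) ?_ ?_ (integral_pairKernel_sq_le P hk hl hk0 hl0 hkB hlB hc hc')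
  · refine ⟨hmain.1, hmain.2.1, hmain.2.2.trans (le_of_eq ?_)⟩
    ring
  · intro w w'
    rw [pairKernel_eq_mixedDiff_right, abs_mul]
    have := abs_mixedDiff_le (F := fun z' : Obs p q =>
      (k w.1.1 z'.1 - k w.2.1 z'.1) * (l w.1.2 z'.2 - l w.2.2 z'.2)) (K := B₁ * B₂)
      (fun z => by
        rw [abs_mul]
        refine mul_le_mul ?_ ?_ (abs_nonneg _) hB₁
        · exact abs_sub_le_of_nonneg_of_le (hk0 _ _) (hkB _ _) (hk0 _ _) (hkB _ _)
        · exact abs_sub_le_of_nonneg_of_le (hl0 _ _) (hlB _ _) (hl0 _ _) (hlB _ _)) w'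
    have h0 := (abs_nonneg _).trans this
    rw [abs_of_pos (by norm_num : (0 : ℝ) < 1 / 4)]
    linarith
  · simp only [← hkdef, ← hldef, integral_pairKernel P hk hl hKa]
    rw [integral_const_mul, integral_mixedDiff P hGm hGK]
    unfold dependenceEnergy
    ring
  · simp only [← hkdef, ← hldef, integral_pairKernel P hk hl hKa, mul_pow]
    rw [integral_const_mul]
    have := integral_mixedDiff_sq_le P hGm hGK
    linarith

/-! ### `L²` norms of averages -/

theorem eLpNorm_two_sq {Ω : Type*} [MeasurableSpace Ω] (μ : Measure Ω) (φ : Ω → ℝ) :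
    eLpNorm φ 2 μ ^ 2 = ∫⁻ ω, ‖φ ω‖ₑ ^ 2 ∂μ := by
  have h := eLpNorm_nnreal_pow_eq_lintegral (f := φ) (p := 2) (μ := μ) two_ne_zero
  have e : ((2 : NNReal) : ℝ) = ((2 : ℕ) : ℝ) := by norm_num
  rw [e] at h
  simp only [ENNReal.rpow_natCast] at h
  exact h

theorem enorm_integral_sq_le {Ω : Type*} [MeasurableSpace Ω] {γ : Measure Ω}
    [IsProbabilityMeasure γ] {φ : Ω → ℝ} (hφ : Measurable φ) :
    ‖∫ t, φ t ∂γ‖ₑ ^ 2 ≤ ∫⁻ t, ‖φ t‖ₑ ^ 2 ∂γ := by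
  rw [← eLpNorm_two_sq]
  gcongr
  refine (enorm_integral_le_lintegral_enorm _).trans ?_
  rw [← eLpNorm_one_eq_lintegral_enorm]
  exact eLpNorm_le_eLpNorm_of_exponent_le (by norm_num) hφ.aestronglyMeasurable

/-- Jensen's inequality for the squared `L²` norm of an average of functions. -/
theorem eLpNorm_integral_sq_le {E Ω : Type*} [MeasurableSpace E] [MeasurableSpace Ω]
    {μ : Measure E} [SFinite μ] {γ : Measure Ω} [IsProbabilityMeasure γ] {V : E → Ω → ℝ}
    (hV : Measurable (Function.uncurry V)) :
    eLpNorm (fun u => ∫ t, V u t ∂γ) 2 μ ^ 2 ≤ ∫⁻ t, eLpNorm (fun u => V u t) 2 μ ^ 2 ∂γ := by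
  simp only [eLpNorm_two_sq]
  refine (lintegral_mono fun u => enorm_integral_sq_le (γ := γ) hV.of_uncurry_left).trans ?_
  rw [lintegral_lintegral_swap]
  exact (hV.enorm.pow_const 2).aemeasurable

theorem eLpNorm_comp_add {ι : Type*} [Fintype ι] {φ : (ι → ℝ) → ℝ} (hφ : Measurable φ) (v : ι → ℝ) :
    eLpNorm (fun u => φ (u + v)) 2 volume = eLpNorm φ 2 volume :=
  eLpNorm_comp_measurePreserving hφ.aestronglyMeasurable
    (measurePreserving_add_right (volume : Measure (ι → ℝ)) v)

/-! ### Second differences of functions in a Nikol'skii-Besov ball -/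

section SecondDiff

variable {ι : Type*} [DecidableEq ι]

theorem update_add_eq (u : ι → ℝ) (i : ι) (v : ℝ) :
    Function.update u i (u i + v) = u + Pi.single i v := by
  ext j
  by_cases h : j = i
  · subst h; simp
  · simp [h]

theorem continuous_piSingle (i : ι) : Continuous fun x : ℝ => (Pi.single i x : ι → ℝ) :=
  (continuous_const (y := (0 : ι → ℝ))).update i continuous_id

/-- The symmetric second difference in the direction of the `i`-th coordinate. -/
def secondDiff (s : (ι → ℝ) → ℝ) (i : ι) (h : ℝ) (u : ι → ℝ) : ℝ :=
  s (u + Pi.single i h) + s (u + Pi.single i (-h)) - 2 * s u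

/-- Fundamental theorem of calculus for `τ ↦ s (u + hτ eᵢ) + s (u - hτ eᵢ)`. Rescaling to the unit
interval makes the right side an average under a probability measure, ready for Jensen's inequality.
-/
theorem secondDiff_eq_integral {s g : (ι → ℝ) → ℝ} (hg : Continuous g) {i : ι}
    (hline : ∀ (u : ι → ℝ) (τ : ℝ), HasDerivAt (fun τ => s (u + Pi.single i τ))
      (g (u + Pi.single i τ)) τ) (h : ℝ) (u : ι → ℝ) :
    secondDiff s i h u = ∫ τ in Set.Ioc (0 : ℝ) 1,
      h * (g (u + Pi.single i (h * τ)) - g (u + Pi.single i (-(h * τ)))) := by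
  rw [← intervalIntegral.integral_of_le zero_le_one]
  have hd : ∀ τ : ℝ, HasDerivAt
      (fun τ => s (u + Pi.single i (h * τ)) + s (u + Pi.single i (-(h * τ))))
      (h * (g (u + Pi.single i (h * τ)) - g (u + Pi.single i (-(h * τ))))) τ := by
    intro τ
    have l1 : HasDerivAt (fun τ : ℝ => h * τ) h τ := by
      simpa using (hasDerivAt_id τ).const_mul h
    have a1 := (hline u (h * τ)).comp τ l1
    have a2 := (hline u (-(h * τ))).comp τ l1.neg
    refine (a1.add a2).congr_deriv ?_
    ring
  have hcont : Continuous fun τ : ℝ =>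
      h * (g (u + Pi.single i (h * τ)) - g (u + Pi.single i (-(h * τ)))) := by
    have c1 : Continuous fun x : ℝ => (Pi.single i x : ι → ℝ) := continuous_piSingle i
    fun_prop
  rw [intervalIntegral.integral_eq_sub_of_hasDerivAt (fun τ _ => hd τ)
    (hcont.intervalIntegrable _ _)]
  simp [secondDiff]
  ring

theorem hasDerivAt_coordinate_line {s : (ι → ℝ) → ℝ} {i : ι}
    (hc : ∀ u : ι → ℝ, ContDiff ℝ 1 fun t : ℝ => s (Function.update u i t)) (u : ι → ℝ) (τ : ℝ) :
    HasDerivAt (fun τ => s (u + Pi.single i τ)) (partialDeriv i 1 s (u + Pi.single i τ)) τ := by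
  have hd : Differentiable ℝ fun t => s (Function.update u i t) :=
    (hc u).differentiable (by norm_num)
  have h3 := (hd (u i + τ)).hasDerivAt
  have h4 : partialDeriv i 1 s (u + Pi.single i τ) =
      deriv (fun t => s (Function.update u i t)) (u i + τ) := by
    rw [partialDeriv, iteratedDeriv_one, ← update_add_eq]
    simp
  rw [h4]
  have h5 := HasDerivAt.comp_const_add (u i) τ h3
  simpa only [update_add_eq] using h5

variable [Fintype ι]

theorem strictFloor_of_le_one {r : ℝ} (h1 : r ≤ 1) : strictFloor r = 0 := by
  unfold strictFloor
  have : ⌈r⌉₊ ≤ 1 := Nat.ceil_le.2 (by simpa using h1)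
  omega

theorem strictFloor_of_one_lt {r : ℝ} (h1 : 1 < r) (h2 : r ≤ 2) : strictFloor r = 1 := by
  unfold strictFloor
  have h : ⌈r⌉₊ ≤ 2 := Nat.ceil_le.2 (by simpa using h2)
  have h' : 1 < ⌈r⌉₊ := Nat.lt_ceil.2 (by simpa using h1)
  omega

/-- No derivative is involved here, the endpoint `δ i = 1` included: the second difference is the
sum of the first differences with steps `h` and `-h`. -/
theorem eLpNorm_secondDiff_le_of_le_one {s : (ι → ℝ) → ℝ} (hs : Measurable s) {δ : ι → ℝ} {R : ℝ}
    (hR : 0 ≤ R) (hball : s ∈ nikolskiiBall δ R) {i : ι} (h1 : δ i ≤ 1) (h : ℝ) :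
    eLpNorm (secondDiff s i h) 2 volume ≤ ENNReal.ofReal (2 * R * |h| ^ δ i) := by
  have hb := (hball i).2.2
  have h0 : partialDeriv i 0 s = s := by
    ext u
    simp [partialDeriv]
  simp only [strictFloor_of_le_one h1, h0, update_add_eq, Nat.cast_zero, sub_zero] at hb
  have m : ∀ v : ι → ℝ, AEStronglyMeasurable (fun u => s (u + v) - s u) volume := fun v =>
    ((hs.comp (measurable_id.add_const v)).sub hs).aestronglyMeasurable
  have e : secondDiff s i h = (fun u => s (u + Pi.single i h) - s u) +
      fun u => s (u + Pi.single i (-h)) - s u := by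
    ext u
    simp only [secondDiff, Pi.add_apply]
    ring
  rw [e]
  refine (eLpNorm_add_le (m _) (m _) (by norm_num)).trans ?_
  refine (add_le_add (hb h) (hb (-h))).trans ?_
  rw [abs_neg, ← ENNReal.ofReal_add (by positivity) (by positivity)]
  apply le_of_eq
  congr 1
  ring

theorem eLpNorm_symmetric_diff_le {g : (ι → ℝ) → ℝ} (hg : Continuous g) {i : ι} {r R : ℝ}
    (hR : 0 ≤ R) (h1 : 1 < r) (h2 : r ≤ 2)
    (hb : ∀ v : ℝ, eLpNorm (fun u => g (u + Pi.single i v) - g u) 2 volume ≤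
      ENNReal.ofReal (R * |v| ^ (r - 1))) (h : ℝ) {τ : ℝ} (hτ : τ ∈ Set.Ioc (0 : ℝ) 1) :
    eLpNorm (fun u : ι → ℝ => h * (g (u + Pi.single i (h * τ)) -
      g (u + Pi.single i (-(h * τ))))) 2 volume ≤ ENNReal.ofReal (2 * R * |h| ^ r) := by
  -- The symmetric difference is a translate of a forward difference with step `2hτ`, and
  -- translation preserves the `L²` norm.
  have e : (fun u : ι → ℝ => h * (g (u + Pi.single i (h * τ)) - g (u + Pi.single i (-(h * τ))))) =
      h • fun u : ι → ℝ => (fun v => g (v + Pi.single i (2 * (h * τ))) - g v)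
        (u + Pi.single i (-(h * τ))) := by
    ext u
    have : u + Pi.single i (-(h * τ)) + Pi.single i (2 * (h * τ)) = u + Pi.single i (h * τ) := by
      rw [add_assoc, ← Pi.single_add]
      congr 2
      ring
    simp only [Pi.smul_apply, smul_eq_mul, this]
  have hm : Measurable fun v => g (v + Pi.single i (2 * (h * τ))) - g v :=
    ((hg.comp (continuous_id.add continuous_const)).sub hg).measurable
  rw [e, eLpNorm_const_smul, eLpNorm_comp_add hm, Real.enorm_eq_ofReal_abs]
  refine (mul_le_mul_right (hb _) _).trans ?_
  rw [← ENNReal.ofReal_mul (abs_nonneg _)]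
  refine ENNReal.ofReal_le_ofReal ?_
  rcases eq_or_ne h 0 with rfl | hh
  · simp only [abs_zero, zero_mul]
    positivity
  have hh' : 0 < |h| := abs_pos.2 hh
  have e1 : |h| ^ r = |h| * |h| ^ (r - 1) := by
    rw [Real.rpow_sub_one hh'.ne']
    field_simp
  -- The factor `2 ^ (r - 1)` is at most 2 because `r ≤ 2`.
  have e2 : |2 * (h * τ)| ^ (r - 1) ≤ 2 * |h| ^ (r - 1) := by
    have : |2 * (h * τ)| ≤ 2 * |h| := by
      rw [abs_mul, abs_mul, abs_of_pos hτ.1, abs_two]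
      nlinarith [hτ.2]
    refine (Real.rpow_le_rpow (abs_nonneg _) this (by linarith)).trans ?_
    rw [Real.mul_rpow (by norm_num) hh'.le]
    refine mul_le_mul_of_nonneg_right ?_ (by positivity)
    calc (2 : ℝ) ^ (r - 1) ≤ 2 ^ (1 : ℝ) :=
          Real.rpow_le_rpow_of_exponent_le (by norm_num) (by linarith)
      _ = 2 := by norm_num
  rw [e1]
  have := mul_le_mul_of_nonneg_left e2 (mul_nonneg hh'.le hR)
  linarith

/-- Here the Hölder condition bears on the first derivative. The integral formula gains one power of
`|h|`, and Jensen's inequality in `τ` moves the `L²` norm inside the integral. -/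
theorem eLpNorm_secondDiff_le_of_one_lt {s : (ι → ℝ) → ℝ} {δ : ι → ℝ} {R : ℝ}
    (hR : 0 ≤ R) (hball : s ∈ nikolskiiBall δ R) {i : ι} (h1 : 1 < δ i) (h2 : δ i ≤ 2) (h : ℝ) :
    eLpNorm (secondDiff s i h) 2 volume ≤ ENNReal.ofReal (2 * R * |h| ^ δ i) := by
  have hball' := hball i
  rw [strictFloor_of_one_lt h1 h2] at hball'
  obtain ⟨hc, hg, hb⟩ := hball'
  simp only [update_add_eq, Nat.cast_one] at hc hb
  have hline := hasDerivAt_coordinate_line hc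
  generalize partialDeriv i 1 s = g at hg hb hline
  have hprob : IsProbabilityMeasure (volume.restrict (Set.Ioc (0 : ℝ) 1)) := ⟨by simp⟩
  have hV : Measurable (Function.uncurry fun (u : ι → ℝ) (τ : ℝ) =>
      h * (g (u + Pi.single i (h * τ)) - g (u + Pi.single i (-(h * τ))))) := by
    have c1 : Continuous fun x : ℝ => (Pi.single i x : ι → ℝ) := continuous_piSingle i
    refine Continuous.measurable ?_
    simp only [Function.uncurry_def]
    fun_prop
  have key : eLpNorm (secondDiff s i h) 2 volume ^ 2 ≤
      ENNReal.ofReal (2 * R * |h| ^ δ i) ^ 2 := by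
    rw [funext (secondDiff_eq_integral hg hline h)]
    refine (eLpNorm_integral_sq_le hV).trans ?_
    refine (setLIntegral_mono (g := fun _ => ENNReal.ofReal (2 * R * |h| ^ δ i) ^ 2)
      measurable_const fun τ hτ =>
        pow_le_pow_left' (eLpNorm_symmetric_diff_le hg hR h1 h2 hb h hτ) 2).trans ?_
    simp
  exact le_of_not_gt fun hlt => absurd key (not_le.2 (ENNReal.pow_lt_pow_left two_ne_zero hlt))

theorem eLpNorm_secondDiff_le {s : (ι → ℝ) → ℝ} (hs : Measurable s) {δ : ι → ℝ} {R : ℝ}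
    (hR : 0 ≤ R) (hball : s ∈ nikolskiiBall δ R) {i : ι} (h2 : δ i ≤ 2) (h : ℝ) :
    eLpNorm (secondDiff s i h) 2 volume ≤ ENNReal.ofReal (2 * R * |h| ^ δ i) := by
  rcases le_or_gt (δ i) 1 with h1 | h1
  · exact eLpNorm_secondDiff_le_of_le_one hs hR hball h1 h
  · exact eLpNorm_secondDiff_le_of_one_lt hR hball h1 h2 h

end SecondDiff

/-! ### Gaussian smoothing -/

open ProbabilityTheory (gaussianReal)

section Smoothing

variable {ι : Type*} [DecidableEq ι]

/-- The displacement of the coordinates in `S` by the multiples `lam i * t i`. -/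
def partialShift (lam : ι → ℝ) (S : Finset ι) (t : ι → ℝ) : ι → ℝ :=
  fun i => if i ∈ S then lam i * t i else 0

/-- The reflection of the `i`-th coordinate. -/
def flipCoord (i : ι) (t : ι → ℝ) : ι → ℝ := fun j => if j = i then -t j else t j

theorem measurable_partialShift (lam : ι → ℝ) (S : Finset ι) : Measurable (partialShift lam S) := by
  refine measurable_pi_lambda _ fun i => ?_
  by_cases h : i ∈ S
  · simp only [partialShift, h, if_true]
    exact (measurable_pi_apply i).const_mul _
  · simp only [partialShift, h, if_false]
    exact measurable_const

theorem partialShift_insert (lam : ι → ℝ) {S : Finset ι} {i : ι} (hi : i ∉ S) (t : ι → ℝ) :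
    partialShift lam (insert i S) t = partialShift lam S t + Pi.single i (lam i * t i) := by
  ext j
  by_cases h : j = i
  · subst h; simp [partialShift, hi]
  · simp [partialShift, h]

theorem partialShift_flipCoord (lam : ι → ℝ) {S : Finset ι} {i : ι} (hi : i ∉ S) (t : ι → ℝ) :
    partialShift lam S (flipCoord i t) = partialShift lam S t := by
  ext j
  by_cases h : j = i
  · subst h; simp [partialShift, hi]
  · simp [partialShift, flipCoord, h]

theorem measurable_shifted {s : (ι → ℝ) → ℝ} (hs : Measurable s) (lam : ι → ℝ) (S : Finset ι) :
    Measurable (Function.uncurry fun u t : ι → ℝ => s (u + partialShift lam S t)) :=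
  hs.comp (measurable_fst.add ((measurable_partialShift lam S).comp measurable_snd))

variable [Fintype ι]

/-- The standard Gaussian distribution on `ℝ^ι`. -/
def stdGaussian (ι : Type*) [Fintype ι] : Measure (ι → ℝ) := Measure.pi fun _ => gaussianReal 0 1

instance : IsProbabilityMeasure (stdGaussian ι) := by
  unfold stdGaussian; infer_instance

theorem measurePreserving_flipCoord (i : ι) :
    MeasurePreserving (flipCoord i) (stdGaussian ι) (stdGaussian ι) := by
  refine measurePreserving_pi (fun _ => gaussianReal 0 1) (fun _ => gaussianReal 0 1)
    (f := fun j x => if j = i then -x else x) fun j => ?_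
  by_cases h : j = i
  · simp only [h, if_true]
    refine ⟨measurable_neg, ?_⟩
    simpa using ProbabilityTheory.gaussianReal_map_neg (μ := 0) (v := 1)
  · simp only [h, if_false]
    exact MeasurePreserving.id _

/-- The average of `s` over Gaussian displacements of the coordinates in `S`. -/
def partialSmooth (s : (ι → ℝ) → ℝ) (lam : ι → ℝ) (S : Finset ι) (u : ι → ℝ) : ℝ :=
  ∫ t, s (u + partialShift lam S t) ∂(stdGaussian ι)

theorem measurable_partialSmooth {s : (ι → ℝ) → ℝ} (hs : Measurable s) (lam : ι → ℝ)
    (S : Finset ι) : Measurable (partialSmooth s lam S) :=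
  (measurable_shifted hs lam S).stronglyMeasurable.integral_prod_right.measurable

/-- Almost every smoothing integral of an integrable function converges. -/
theorem ae_integrable_shifted {s : (ι → ℝ) → ℝ} (hs : Measurable s) (hi : Integrable s volume)
    (lam : ι → ℝ) (S : Finset ι) :
    ∀ᵐ u : ι → ℝ, Integrable (fun t => s (u + partialShift lam S t)) (stdGaussian ι) := by
  have hm := measurable_shifted hs lam S
  have hfin : ∫⁻ u : ι → ℝ, ∫⁻ t, ‖s (u + partialShift lam S t)‖ₑ ∂(stdGaussian ι) ≠ ∞ := by
    rw [lintegral_lintegral_swap hm.enorm.aemeasurable]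
    have : ∀ t, ∫⁻ u : ι → ℝ, ‖s (u + partialShift lam S t)‖ₑ = ∫⁻ u, ‖s u‖ₑ := fun t =>
      lintegral_add_right_eq_self (fun u => ‖s u‖ₑ) _
    simp only [this]
    simpa using hi.hasFiniteIntegral.ne
  have hmeas : Measurable fun u : ι → ℝ =>
      ∫⁻ t, ‖s (u + partialShift lam S t)‖ₑ ∂(stdGaussian ι) :=
    hm.enorm.lintegral_prod_right'
  filter_upwards [ae_lt_top hmeas hfin] with u hu
  exact ⟨(hm.of_uncurry_left (x := u)).aestronglyMeasurable, hu⟩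

/-- The Gaussian law is invariant under reflection of the coordinate `i`, so the shift by `lam i * t
i` may be averaged with its opposite. First-order terms cancel and a second difference is left. -/
theorem partialSmooth_sub_insert {s : (ι → ℝ) → ℝ} (hs : Measurable s) (lam : ι → ℝ)
    {S : Finset ι} {i : ι} (hi : i ∉ S) {u : ι → ℝ}
    (hS : Integrable (fun t => s (u + partialShift lam S t)) (stdGaussian ι))
    (hS' : Integrable (fun t => s (u + partialShift lam (insert i S) t)) (stdGaussian ι)) :
    partialSmooth s lam S u - partialSmooth s lam (insert i S) u =
      ∫ t, -(1 / 2) * secondDiff s i (lam i * t i) (u + partialShift lam S t)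
        ∂(stdGaussian ι) := by
  have hm := (measurable_shifted hs lam (insert i S)).of_uncurry_left (x := u)
  have hfl := measurePreserving_flipCoord i
  have e1 := integral_comp_of_measurePreserving hfl hm
  have hflip : ∀ t, partialShift lam (insert i S) (flipCoord i t) =
      partialShift lam S t + Pi.single i (-(lam i * t i)) := by
    intro t
    rw [partialShift_insert lam hi, partialShift_flipCoord lam hi]
    simp [flipCoord]
  have hint : Integrable (fun t => s (u + partialShift lam (insert i S) (flipCoord i t)))
      (stdGaussian ι) := hfl.integrable_comp_of_integrable hS'
  have e2 : partialSmooth s lam (insert i S) u = 1 / 2 *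
      (∫ t, s (u + partialShift lam (insert i S) t) ∂(stdGaussian ι) +
       ∫ t, s (u + partialShift lam (insert i S) (flipCoord i t)) ∂(stdGaussian ι)) := by
    rw [e1]
    unfold partialSmooth
    ring
  have h12 : Integrable (fun t => 1 / 2 * (s (u + partialShift lam (insert i S) t) +
      s (u + partialShift lam (insert i S) (flipCoord i t)))) (stdGaussian ι) :=
    (hS'.add hint).const_mul _
  rw [e2, ← integral_add hS' hint, ← integral_const_mul, partialSmooth, ← integral_sub hS h12]
  refine integral_congr_ae (ae_of_all _ fun t => ?_)
  simp only [hflip, partialShift_insert lam hi, secondDiff, add_assoc]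
  ring

theorem measurable_secondDiff_shift {s : (ι → ℝ) → ℝ} (hs : Measurable s) (lam : ι → ℝ)
    (S : Finset ι) (i : ι) : Measurable (Function.uncurry fun u t : ι → ℝ =>
      -(1 / 2) * secondDiff s i (lam i * t i) (u + partialShift lam S t)) := by
  have h1 : Measurable fun p : (ι → ℝ) × (ι → ℝ) => p.1 + partialShift lam S p.2 :=
    measurable_fst.add ((measurable_partialShift lam S).comp measurable_snd)
  have h2 : Measurable fun x : ℝ => (Pi.single i x : ι → ℝ) := (continuous_piSingle i).measurable
  have h3 : Measurable fun p : (ι → ℝ) × (ι → ℝ) => lam i * p.2 i := by fun_prop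
  have h4 := h1.add (h2.comp h3)
  have h5 := h1.add (h2.comp h3.neg)
  exact (((hs.comp h4).add (hs.comp h5)).sub ((hs.comp h1).const_mul 2)).const_mul _

/-- For `0 < r ≤ 2` one has `|x| ^ (2r) ≤ 1 + x ^ 4`, so one constant serves all regularities. -/
theorem gaussian_moment_bound : ∃ κ : ℝ, 0 < κ ∧ ∀ r : ℝ, 0 < r → r ≤ 2 →
    ∫⁻ x, ENNReal.ofReal (|x| ^ r) ^ 2 ∂(gaussianReal 0 1) ≤ ENNReal.ofReal κ ^ 2 := by
  have h4 : Integrable (fun x : ℝ => x ^ 4) (gaussianReal 0 1) := by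
    have := (ProbabilityTheory.memLp_id_gaussianReal (μ := 0) (v := 1) 4).integrable_norm_pow
      (p := 4) (by norm_num)
    refine this.congr (ae_of_all _ fun x => ?_)
    simp only [id, Real.norm_eq_abs]
    exact (Even.pow_abs (by decide) x)
  have h5 : Integrable (fun x : ℝ => 1 + x ^ 4) (gaussianReal 0 1) :=
    (integrable_const 1).add h4
  have hpos : 0 < ∫ x, (1 + x ^ 4) ∂(gaussianReal 0 1) := by
    rw [integral_add (integrable_const 1) h4]
    have : 0 ≤ ∫ x : ℝ, x ^ 4 ∂(gaussianReal 0 1) :=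
      integral_nonneg fun x => by positivity
    simp
    linarith
  refine ⟨Real.sqrt (∫ x, (1 + x ^ 4) ∂(gaussianReal 0 1)), Real.sqrt_pos.2 hpos, fun r hr hr2 => ?_⟩
  rw [← ENNReal.ofReal_pow (Real.sqrt_nonneg _), Real.sq_sqrt hpos.le,
    ofReal_integral_eq_lintegral_ofReal h5 (ae_of_all _ fun x => by positivity)]
  refine lintegral_mono fun x => ?_
  rw [← ENNReal.ofReal_pow (by positivity)]
  refine ENNReal.ofReal_le_ofReal ?_
  have ha := abs_nonneg x
  have hx4 : x ^ 4 = |x| ^ 4 := (Even.pow_abs (by decide) x).symm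
  rw [hx4]
  rcases le_or_gt |x| 1 with h | h
  · have h1 := Real.rpow_le_one ha h hr.le
    have h2 : 0 ≤ |x| ^ r := by positivity
    have h3 : 0 ≤ |x| ^ 4 := by positivity
    nlinarith
  · have h1 : |x| ^ r ≤ |x| ^ (2 : ℝ) := Real.rpow_le_rpow_of_exponent_le h.le hr2
    rw [Real.rpow_two] at h1
    have h2 : 0 ≤ |x| ^ r := by positivity
    have := pow_le_pow_left₀ h2 h1 2
    nlinarith

/-- Jensen's inequality moves the squared norm inside the Gaussian average, translation invariance
removes the shift of the coordinates in `S`, and a Gaussian moment of order `2 * δ i` remains. -/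
theorem eLpNorm_partialSmooth_sub_insert_le {s : (ι → ℝ) → ℝ} (hs : Measurable s)
    (hint : Integrable s volume) {lam δ : ι → ℝ} {R κ : ℝ} (hR : 0 ≤ R)
    (hball : s ∈ nikolskiiBall δ R) {S : Finset ι} {i : ι} (hi : i ∉ S) (hlam : 0 ≤ lam i)
    (h2 : δ i ≤ 2)
    (hκ : ∫⁻ x, ENNReal.ofReal (|x| ^ δ i) ^ 2 ∂(gaussianReal 0 1) ≤ ENNReal.ofReal κ ^ 2) :
    eLpNorm (partialSmooth s lam S - partialSmooth s lam (insert i S)) 2 volume ≤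
      ENNReal.ofReal (R * lam i ^ δ i) * ENNReal.ofReal κ := by
  have hae : partialSmooth s lam S - partialSmooth s lam (insert i S) =ᵐ[volume] fun u =>
      ∫ t, -(1 / 2) * secondDiff s i (lam i * t i) (u + partialShift lam S t)
        ∂(stdGaussian ι) := by
    filter_upwards [ae_integrable_shifted hs hint lam S,
      ae_integrable_shifted hs hint lam (insert i S)] with u h h'
    exact partialSmooth_sub_insert hs lam hi h h'
  rw [eLpNorm_congr_ae hae]
  have hsd : ∀ h, Measurable (secondDiff s i h) := fun h =>
    ((hs.comp (measurable_id.add_const _)).add (hs.comp (measurable_id.add_const _))).sub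
      (hs.const_mul 2)
  have hpt : ∀ t : ι → ℝ, eLpNorm (fun u => -(1 / 2) *
      secondDiff s i (lam i * t i) (u + partialShift lam S t)) 2 volume ^ 2 ≤
      ENNReal.ofReal (R * lam i ^ δ i) ^ 2 * ENNReal.ofReal (|t i| ^ δ i) ^ 2 := by
    intro t
    rw [← mul_pow]
    refine pow_le_pow_left' ?_ 2
    have e : (fun u => -(1 / 2) * secondDiff s i (lam i * t i) (u + partialShift lam S t)) =
        (-(1 / 2) : ℝ) • fun u => secondDiff s i (lam i * t i) (u + partialShift lam S t) := rfl
    rw [e, eLpNorm_const_smul, eLpNorm_comp_add (hsd _), Real.enorm_eq_ofReal_abs]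
    refine (mul_le_mul_right (eLpNorm_secondDiff_le hs hR hball h2 _) _).trans ?_
    rw [← ENNReal.ofReal_mul (abs_nonneg _), ← ENNReal.ofReal_mul (by positivity), abs_mul,
      abs_of_nonneg hlam, Real.mul_rpow hlam (abs_nonneg _)]
    apply le_of_eq
    congr 1
    rw [abs_neg, abs_of_pos (by norm_num : (0 : ℝ) < 1 / 2)]
    ring
  have hev := measurePreserving_eval (fun _ : ι => gaussianReal 0 1) i
  have hmom : ∫⁻ t : ι → ℝ, ENNReal.ofReal (|t i| ^ δ i) ^ 2 ∂(stdGaussian ι) =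
      ∫⁻ x, ENNReal.ofReal (|x| ^ δ i) ^ 2 ∂(gaussianReal 0 1) :=
    hev.lintegral_comp (f := fun x => ENNReal.ofReal (|x| ^ δ i) ^ 2) (by fun_prop)
  have key : eLpNorm (fun u => ∫ t, -(1 / 2) *
      secondDiff s i (lam i * t i) (u + partialShift lam S t) ∂(stdGaussian ι)) 2 volume ^ 2 ≤
      (ENNReal.ofReal (R * lam i ^ δ i) * ENNReal.ofReal κ) ^ 2 := by
    refine (eLpNorm_integral_sq_le (measurable_secondDiff_shift hs lam S i)).trans ?_
    refine (lintegral_mono hpt).trans ?_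
    rw [lintegral_const_mul _ (by fun_prop), hmom, mul_pow]
    exact mul_le_mul_right hκ _
  exact le_of_not_gt fun hlt => absurd key (not_le.2 (ENNReal.pow_lt_pow_left two_ne_zero hlt))

/-- Regularity is assumed only along each axis, so the coordinates are smoothed one at a time. The
errors telescope and add by the triangle inequality. -/
theorem eLpNorm_sub_partialSmooth_le {s : (ι → ℝ) → ℝ} (hs : Measurable s)
    (hint : Integrable s volume) {lam δ : ι → ℝ} {R κ : ℝ} (hR : 0 ≤ R) (hκ0 : 0 ≤ κ)
    (hball : s ∈ nikolskiiBall δ R) (hlam : ∀ i, 0 ≤ lam i) (h2 : ∀ i, δ i ≤ 2)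
    (hκ : ∀ i, ∫⁻ x, ENNReal.ofReal (|x| ^ δ i) ^ 2 ∂(gaussianReal 0 1) ≤ ENNReal.ofReal κ ^ 2)
    (S : Finset ι) :
    eLpNorm (s - partialSmooth s lam S) 2 volume ≤
      ENNReal.ofReal (κ * R * ∑ i ∈ S, lam i ^ δ i) := by
  induction S using Finset.induction_on with
  | empty =>
    have : partialSmooth s lam ∅ = s := by
      ext u
      have e : ∀ t, partialShift lam ∅ t = 0 := fun t => by ext; simp [partialShift]
      simp [partialSmooth, e]
    simp [this]
  | insert i S hi ih =>
    have e : s - partialSmooth s lam (insert i S) = (s - partialSmooth s lam S) +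
        (partialSmooth s lam S - partialSmooth s lam (insert i S)) := by abel
    have m := fun T => measurable_partialSmooth hs lam T
    rw [e]
    refine (eLpNorm_add_le (hs.sub (m _)).aestronglyMeasurable
      ((m _).sub (m _)).aestronglyMeasurable (by norm_num)).trans ?_
    refine (add_le_add ih (eLpNorm_partialSmooth_sub_insert_le hs hint hR hball hi (hlam i) (h2 i)
      (hκ i))).trans ?_
    have hl : ∀ j, 0 ≤ lam j ^ δ j := fun j => Real.rpow_nonneg (hlam j) _
    rw [← ENNReal.ofReal_mul (mul_nonneg hR (hl i)),
      ← ENNReal.ofReal_add (mul_nonneg (mul_nonneg hκ0 hR) (Finset.sum_nonneg fun j _ => hl j))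
      (mul_nonneg (mul_nonneg hR (hl i)) hκ0), Finset.sum_insert hi]
    apply le_of_eq
    congr 1
    ring

end Smoothing

/-! ### The Gaussian kernel as a Gaussian density -/

open ProbabilityTheory (gaussianReal gaussianPDFReal)

theorem gaussianKernel_eq_prod {d : ℕ} {lam : Fin d → ℝ} (hlam : ∀ i, 0 < lam i)
    (x x' : Fin d → ℝ) :
    gaussianKernel lam x x' = ∏ i, gaussianPDFReal (x i) (Real.toNNReal (lam i ^ 2)) (x' i) := by
  have hpi : (0 : ℝ) < 2 * Real.pi := by positivity
  have h : ∀ i, gaussianPDFReal (x i) (Real.toNNReal (lam i ^ 2)) (x' i) =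
      (lam i)⁻¹ * ((2 * Real.pi) ^ ((1 : ℝ) / 2))⁻¹ *
        Real.exp (-(1 / 2) * ((x i - x' i) / lam i) ^ 2) := by
    intro i
    have hl := hlam i
    rw [ProbabilityTheory.gaussianPDFReal_def]
    simp only [Real.coe_toNNReal _ (sq_nonneg (lam i))]
    rw [Real.sqrt_mul hpi.le, Real.sqrt_sq hl.le, mul_inv, Real.sqrt_eq_rpow,
      mul_comm (((2 * Real.pi) ^ ((1 : ℝ) / 2))⁻¹)]
    congr 2
    field_simp
    ring
  unfold gaussianKernel scaledGaussian gaussianDensity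
  simp only [h]
  rw [Finset.prod_mul_distrib, Finset.prod_mul_distrib, ← Real.exp_sum, ← Finset.mul_sum,
    Finset.prod_inv_distrib, Finset.prod_const, Finset.card_univ, Fintype.card_fin, inv_pow,
    ← Real.rpow_natCast, ← Real.rpow_mul hpi.le]
  rw [one_div, one_div, mul_assoc]
  congr 4
  ring

theorem gaussianKernel_nonneg {d : ℕ} {lam : Fin d → ℝ} (hlam : ∀ i, 0 < lam i)
    (x x' : Fin d → ℝ) : 0 ≤ gaussianKernel lam x x' := by
  rw [gaussianKernel_eq_prod hlam]
  exact Finset.prod_nonneg fun i _ => ProbabilityTheory.gaussianPDFReal_nonneg _ _ _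

theorem gaussianKernel_le {d : ℕ} {lam : Fin d → ℝ} (hlam : ∀ i, 0 < lam i)
    (x x' : Fin d → ℝ) : gaussianKernel lam x x' ≤ (∏ i, lam i)⁻¹ := by
  have hprod : 0 < ∏ i, lam i := Finset.prod_pos fun i _ => hlam i
  unfold gaussianKernel scaledGaussian gaussianDensity
  rw [one_div (∏ i, lam i)]
  refine mul_le_of_le_one_right (by positivity) (mul_le_one₀ ?_ (Real.exp_nonneg _) ?_)
  · rw [div_le_one (by positivity)]
    exact Real.one_le_rpow (by linarith [Real.pi_gt_three]) (by positivity)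
  · rw [Real.exp_le_one_iff]
    have : 0 ≤ ∑ i, ((x i - x' i) / lam i) ^ 2 := Finset.sum_nonneg fun i _ => sq_nonneg _
    linarith

theorem measurable_gaussianKernel {d : ℕ} (lam : Fin d → ℝ) :
    Measurable (Function.uncurry (gaussianKernel lam)) := by
  unfold gaussianKernel scaledGaussian gaussianDensity
  simp only [Function.uncurry_def]
  fun_prop

theorem integrable_gaussianKernel {d : ℕ} {lam : Fin d → ℝ} (hlam : ∀ i, 0 < lam i)
    (x : Fin d → ℝ) : Integrable (gaussianKernel lam x) volume := by
  simp only [funext (gaussianKernel_eq_prod hlam x)]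
  exact Integrable.fintype_prod fun i => ProbabilityTheory.integrable_gaussianPDFReal _ _

theorem integral_gaussianKernel {d : ℕ} {lam : Fin d → ℝ} (hlam : ∀ i, 0 < lam i)
    (x : Fin d → ℝ) : ∫ x', gaussianKernel lam x x' = 1 := by
  simp only [gaussianKernel_eq_prod hlam x]
  rw [integral_fintype_prod_volume_eq_prod
    (fun i => gaussianPDFReal (x i) (Real.toNNReal (lam i ^ 2)))]
  refine Finset.prod_eq_one fun i _ => ProbabilityTheory.integral_gaussianPDFReal_eq_one _ ?_
  have := hlam i
  simp only [ne_eq, Real.toNNReal_eq_zero, not_le]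
  positivity

/-- A product of measures with integrable densities has the product density. -/
theorem pi_withDensity_ofReal {ι : Type*} [Fintype ι] {φ : ι → ℝ → ℝ}
    (h0 : ∀ i x, 0 ≤ φ i x) (hi : ∀ i, Integrable (φ i) volume) :
    (Measure.pi fun i => (volume : Measure ℝ).withDensity fun x => ENNReal.ofReal (φ i x)) =
      (volume : Measure (ι → ℝ)).withDensity fun u => ENNReal.ofReal (∏ i, φ i (u i)) := by
  have : ∀ i, IsFiniteMeasure
      ((volume : Measure ℝ).withDensity fun x => ENNReal.ofReal (φ i x)) := fun i =>
    isFiniteMeasure_withDensity_ofReal (hi i).hasFiniteIntegral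
  refine Measure.pi_eq fun s hs => ?_
  have hpi : Integrable (fun u : ι → ℝ => ∏ i, φ i (u i)) volume := Integrable.fintype_prod hi
  rw [withDensity_apply _ (.univ_pi hs),
    ← ofReal_integral_eq_lintegral_ofReal hpi.integrableOn
      (ae_of_all _ fun u => Finset.prod_nonneg fun i _ => h0 i _),
    ← integral_indicator (.univ_pi hs)]
  have e : ∀ i, ((volume : Measure ℝ).withDensity fun x => ENNReal.ofReal (φ i x)) (s i) =
      ENNReal.ofReal (∫ x, (s i).indicator (φ i) x) := by
    intro i
    rw [withDensity_apply _ (hs i), ← ofReal_integral_eq_lintegral_ofReal (hi i).integrableOn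
      (ae_of_all _ (h0 i)), integral_indicator (hs i)]
  simp only [e]
  rw [← ENNReal.ofReal_prod_of_nonneg fun i _ => integral_nonneg fun x =>
    Set.indicator_nonneg (fun x _ => h0 i x) x,
    ← integral_fintype_prod_volume_eq_prod (fun i => (s i).indicator (φ i))]
  congr 2
  ext u
  by_cases hu : u ∈ Set.univ.pi s
  · rw [Set.indicator_of_mem hu]
    exact Finset.prod_congr rfl fun i _ =>
      (Set.indicator_of_mem (hu i (Set.mem_univ i)) _).symm
  · rw [Set.indicator_of_notMem hu]
    simp only [Set.mem_pi, Set.mem_univ, true_implies, not_forall] at hu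
    obtain ⟨i, hi'⟩ := hu
    exact (Finset.prod_eq_zero (Finset.mem_univ i) (Set.indicator_of_notMem hi' _)).symm

/-- If `t` is standard Gaussian, then `u + lam * t` has independent coordinates of mean `u i` and
variance `lam i ^ 2`; its density is the product kernel centred at `u`. -/
theorem partialSmooth_univ_eq_integral {ι : Type*} [Fintype ι] [DecidableEq ι]
    {s : (ι → ℝ) → ℝ} (hs : Measurable s) {lam : ι → ℝ} (hlam : ∀ i, 0 < lam i) (u : ι → ℝ) :
    partialSmooth s lam Finset.univ u =
      ∫ v, (∏ i, gaussianPDFReal (u i) (Real.toNNReal (lam i ^ 2)) (v i)) * s v := by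
  have hv : ∀ i, Real.toNNReal (lam i ^ 2) ≠ 0 := fun i => by
    have := hlam i
    simp only [ne_eq, Real.toNNReal_eq_zero, not_le]
    positivity
  have hmap : ∀ i, (gaussianReal 0 1).map (fun t => u i + lam i * t) =
      gaussianReal (u i) (Real.toNNReal (lam i ^ 2)) := by
    intro i
    have h1 := ProbabilityTheory.gaussianReal_map_const_mul (μ := 0) (v := 1) (lam i)
    have h2 := ProbabilityTheory.gaussianReal_map_const_add (μ := lam i * 0)
      (v := NNReal.mk (lam i ^ 2) (sq_nonneg _) * 1) (u i)
    rw [← h1, Measure.map_map (by fun_prop) (by fun_prop)] at h2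
    refine h2.trans ?_
    simp only [mul_zero, zero_add, mul_one]
    congr 1
    exact (Real.toNNReal_of_nonneg (sq_nonneg _)).symm
  have hmp : MeasurePreserving (fun t : ι → ℝ => fun i => u i + lam i * t i) (stdGaussian ι)
      (Measure.pi fun i => gaussianReal (u i) (Real.toNNReal (lam i ^ 2))) :=
    measurePreserving_pi _ _ fun i => ⟨by fun_prop, hmap i⟩
  have e1 : partialSmooth s lam Finset.univ u =
      ∫ v, s v ∂(Measure.pi fun i => gaussianReal (u i) (Real.toNNReal (lam i ^ 2))) := by
    rw [← integral_comp_of_measurePreserving hmp hs]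
    unfold partialSmooth
    refine integral_congr_ae (ae_of_all _ fun t => ?_)
    simp only
    congr 1
    ext i
    simp [partialShift]
  have e2 : (Measure.pi fun i => gaussianReal (u i) (Real.toNNReal (lam i ^ 2))) =
      (volume : Measure (ι → ℝ)).withDensity fun v => ENNReal.ofReal
        (∏ i, gaussianPDFReal (u i) (Real.toNNReal (lam i ^ 2)) (v i)) := by
    rw [← pi_withDensity_ofReal (φ := fun i => gaussianPDFReal (u i) (Real.toNNReal (lam i ^ 2)))
      (fun i x => ProbabilityTheory.gaussianPDFReal_nonneg _ _ _)
      (fun i => ProbabilityTheory.integrable_gaussianPDFReal _ _)]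
    congr 1
    ext1 i
    exact ProbabilityTheory.gaussianReal_of_var_ne_zero _ (hv i)
  rw [e1, e2, integral_withDensity_eq_integral_toReal_smul]
  · refine integral_congr_ae (ae_of_all _ fun v => ?_)
    simp only [smul_eq_mul]
    rw [ENNReal.toReal_ofReal (Finset.prod_nonneg fun i _ =>
      ProbabilityTheory.gaussianPDFReal_nonneg _ _ _)]
  · refine ENNReal.measurable_ofReal.comp (Finset.measurable_prod _ fun i _ => ?_)
    exact (ProbabilityTheory.measurable_gaussianPDFReal _ _).comp (measurable_pi_apply i)
  · exact ae_of_all _ fun v => ENNReal.ofReal_lt_top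

/-! ### Coordinates -/

theorem measurePreserving_splitCoordinates (p q : ℕ) :
    MeasurePreserving (fun u : Fin p ⊕ Fin q → ℝ =>
      ((fun i => u (Sum.inl i), fun j => u (Sum.inr j)) : Obs p q)) volume volume :=
  volume_measurePreserving_sumPiEquivProdPi (fun _ : Fin p ⊕ Fin q => ℝ)

theorem measurable_toCoordinates {p q : ℕ} {s : Obs p q → ℝ} (hs : Measurable s) :
    Measurable (toCoordinates s) :=
  hs.comp (measurePreserving_splitCoordinates p q).measurable

/-- Smoothing by the product of the Gaussian kernels is Gaussian smoothing in coordinates. -/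
theorem partialSmooth_toCoordinates {p q : ℕ} {s : Obs p q → ℝ} (hs : Measurable s)
    {lam : Fin p → ℝ} {mu : Fin q → ℝ} (hlam : ∀ i, 0 < lam i) (hmu : ∀ j, 0 < mu j) :
    partialSmooth (toCoordinates s) (Sum.elim lam mu) Finset.univ =
      toCoordinates fun z => ∫ z', gaussianKernel lam z.1 z'.1 * gaussianKernel mu z.2 z'.2 *
        s z' := by
  ext u
  rw [partialSmooth_univ_eq_integral (measurable_toCoordinates hs)
    (by rintro (i | j) <;> simp [hlam, hmu])]
  unfold toCoordinates
  have hk := measurable_gaussianKernel lam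
  have hl := measurable_gaussianKernel mu
  simp only
  rw [← integral_comp_of_measurePreserving (measurePreserving_splitCoordinates p q)]
  · refine integral_congr_ae (ae_of_all _ fun v => ?_)
    simp only [Fintype.prod_sum_type, Sum.elim_inl, Sum.elim_inr]
    rw [gaussianKernel_eq_prod hlam, gaussianKernel_eq_prod hmu]
  · refine Measurable.mul (Measurable.mul ?_ ?_) hs
    · exact hk.comp (f := fun z' : Obs p q => (fun i => u (Sum.inl i), z'.1)) (by fun_prop)
    · exact hl.comp (f := fun z' : Obs p q => (fun j => u (Sum.inr j), z'.2)) (by fun_prop)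

theorem eLpNorm_toCoordinates {p q : ℕ} {s : Obs p q → ℝ} (hs : Measurable s) :
    eLpNorm (toCoordinates s) 2 volume = eLpNorm s 2 volume :=
  eLpNorm_comp_measurePreserving hs.aestronglyMeasurable (measurePreserving_splitCoordinates p q)

/-! ### Densities and their marginals -/

section Density

variable {p q : ℕ} {f : Obs p q → ℝ}

/-- The law of an observation with density `f`. -/
def obsLaw (f : Obs p q → ℝ) : Measure (Obs p q) :=
  (volume : Measure (Obs p q)).withDensity fun z => ENNReal.ofReal (f z)

theorem IsDensity.integrable (hf : IsDensity f) : Integrable f volume := by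
  refine ⟨hf.1.aestronglyMeasurable, ?_⟩
  rw [hasFiniteIntegral_iff_ofReal (ae_of_all _ hf.2.1), hf.2.2]
  exact ENNReal.one_lt_top

theorem IsDensity.integral_eq_one (hf : IsDensity f) : ∫ z, f z = 1 := by
  rw [integral_eq_lintegral_of_nonneg_ae (ae_of_all _ hf.2.1) hf.1.aestronglyMeasurable, hf.2.2]
  simp

theorem IsDensity.isProbabilityMeasure (hf : IsDensity f) : IsProbabilityMeasure (obsLaw f) := by
  refine ⟨?_⟩
  rw [obsLaw, withDensity_apply _ .univ, setLIntegral_univ, hf.2.2]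

theorem integral_obsLaw (hf : IsDensity f) (φ : Obs p q → ℝ) :
    ∫ z, φ z ∂(obsLaw f) = ∫ z, f z * φ z := by
  rw [obsLaw, integral_withDensity_eq_integral_toReal_smul hf.1.ennreal_ofReal
    (ae_of_all _ fun z => ENNReal.ofReal_lt_top)]
  refine integral_congr_ae (ae_of_all _ fun z => ?_)
  simp only [smul_eq_mul]
  rw [ENNReal.toReal_ofReal (hf.2.1 z)]

theorem IsDensity.measurable_marginalX (hf : IsDensity f) : Measurable (marginalX f) :=
  hf.1.stronglyMeasurable.integral_prod_right'.measurable

theorem IsDensity.measurable_marginalY (hf : IsDensity f) : Measurable (marginalY f) :=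
  hf.1.stronglyMeasurable.integral_prod_left'.measurable

theorem IsDensity.marginalX_nonneg (hf : IsDensity f) (x : Fin p → ℝ) : 0 ≤ marginalX f x :=
  integral_nonneg fun _ => hf.2.1 _

theorem IsDensity.marginalY_nonneg (hf : IsDensity f) (y : Fin q → ℝ) : 0 ≤ marginalY f y :=
  integral_nonneg fun _ => hf.2.1 _

/-- Only almost everywhere: where the section of `f` is not integrable, the marginal takes the
default value 0 of the integral. -/
theorem IsDensity.ae_lintegral_eq_marginalX (hf : IsDensity f) :
    ∀ᵐ x, ∫⁻ y, ENNReal.ofReal (f (x, y)) = ENNReal.ofReal (marginalX f x) := by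
  filter_upwards [hf.integrable.prod_right_ae] with x hx
  rw [marginalX, ofReal_integral_eq_lintegral_ofReal hx (ae_of_all _ fun y => hf.2.1 _)]

theorem IsDensity.ae_lintegral_eq_marginalY (hf : IsDensity f) :
    ∀ᵐ y, ∫⁻ x, ENNReal.ofReal (f (x, y)) = ENNReal.ofReal (marginalY f y) := by
  filter_upwards [hf.integrable.prod_left_ae] with y hy
  rw [marginalY, ofReal_integral_eq_lintegral_ofReal hy (ae_of_all _ fun y => hf.2.1 _)]

theorem IsDensity.map_fst (hf : IsDensity f) : (obsLaw f).map Prod.fst =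
    (volume : Measure (Fin p → ℝ)).withDensity fun x => ENNReal.ofReal (marginalX f x) := by
  ext s hs
  have h := hf.1.ennreal_ofReal
  rw [Measure.map_apply measurable_fst hs, obsLaw, withDensity_apply _ (measurable_fst hs),
    withDensity_apply _ hs]
  have e : (Prod.fst ⁻¹' s : Set (Obs p q)) = s ×ˢ Set.univ := by ext; simp
  rw [e, Measure.volume_eq_prod, setLIntegral_prod _ h.aemeasurable]
  simp only [Measure.restrict_univ]
  exact lintegral_congr_ae (ae_restrict_of_ae hf.ae_lintegral_eq_marginalX)

theorem IsDensity.map_snd (hf : IsDensity f) : (obsLaw f).map Prod.snd =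
    (volume : Measure (Fin q → ℝ)).withDensity fun y => ENNReal.ofReal (marginalY f y) := by
  ext s hs
  have h := hf.1.ennreal_ofReal
  rw [Measure.map_apply measurable_snd hs, obsLaw, withDensity_apply _ (measurable_snd hs),
    withDensity_apply _ hs]
  have e : (Prod.snd ⁻¹' s : Set (Obs p q)) = Set.univ ×ˢ s := by ext; simp
  rw [e, Measure.volume_eq_prod, setLIntegral_prod_symm _ h.aemeasurable]
  simp only [Measure.restrict_univ]
  exact lintegral_congr_ae (ae_restrict_of_ae hf.ae_lintegral_eq_marginalY)

theorem IsDensity.lintegral_marginalX (hf : IsDensity f) :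
    ∫⁻ x, ENNReal.ofReal (marginalX f x) = 1 := by
  rw [← lintegral_congr_ae hf.ae_lintegral_eq_marginalX, ← hf.2.2, Measure.volume_eq_prod,
    lintegral_prod _ hf.1.ennreal_ofReal.aemeasurable]

theorem IsDensity.lintegral_marginalY (hf : IsDensity f) :
    ∫⁻ y, ENNReal.ofReal (marginalY f y) = 1 := by
  rw [← lintegral_congr_ae hf.ae_lintegral_eq_marginalY, ← hf.2.2, Measure.volume_eq_prod,
    lintegral_prod_symm _ hf.1.ennreal_ofReal.aemeasurable]

theorem IsDensity.integral_marginalX (hf : IsDensity f) : ∫ x, marginalX f x = 1 := by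
  rw [integral_eq_lintegral_of_nonneg_ae (ae_of_all _ hf.marginalX_nonneg)
    hf.measurable_marginalX.aestronglyMeasurable, hf.lintegral_marginalX]
  simp

theorem IsDensity.integral_marginalY (hf : IsDensity f) : ∫ y, marginalY f y = 1 := by
  rw [integral_eq_lintegral_of_nonneg_ae (ae_of_all _ hf.marginalY_nonneg)
    hf.measurable_marginalY.aestronglyMeasurable, hf.lintegral_marginalY]
  simp

theorem IsDensity.measurable_productOfMarginals (hf : IsDensity f) :
    Measurable (productOfMarginals f) :=
  (hf.measurable_marginalX.comp measurable_fst).mul (hf.measurable_marginalY.comp measurable_snd)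

theorem IsDensity.productOfMarginals (hf : IsDensity f) : IsDensity (productOfMarginals f) := by
  refine ⟨hf.measurable_productOfMarginals, fun z =>
    mul_nonneg (hf.marginalX_nonneg _) (hf.marginalY_nonneg _), ?_⟩
  have e : ∀ z : Obs p q, ENNReal.ofReal (HSIC.productOfMarginals f z) =
      ENNReal.ofReal (marginalX f z.1) * ENNReal.ofReal (marginalY f z.2) := fun z =>
    ENNReal.ofReal_mul (hf.marginalX_nonneg _)
  simp only [e]
  rw [Measure.volume_eq_prod, lintegral_prod_mul
    hf.measurable_marginalX.ennreal_ofReal.aemeasurable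
    hf.measurable_marginalY.ennreal_ofReal.aemeasurable, hf.lintegral_marginalX,
    hf.lintegral_marginalY, one_mul]

theorem IsDensity.prodMarginals_obsLaw (hf : IsDensity f) :
    prodMarginals (obsLaw f) = obsLaw (HSIC.productOfMarginals f) := by
  have h1 := hf.measurable_marginalX.ennreal_ofReal
  have h2 := hf.measurable_marginalY.ennreal_ofReal
  rw [prodMarginals, hf.map_fst, hf.map_snd, prod_withDensity h1 h2, obsLaw,
    Measure.volume_eq_prod]
  congr 1
  ext z
  exact (ENNReal.ofReal_mul (hf.marginalX_nonneg _)).symm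

/-- The marginals have integral one, so the identity holds at every point. It makes the dependence
part vanish identically under `P_{f₁ ⊗ f₂}`, the law that defines the critical value. -/
theorem IsDensity.productOfMarginals_idem (hf : IsDensity f) :
    HSIC.productOfMarginals (HSIC.productOfMarginals f) = HSIC.productOfMarginals f := by
  have h1 : marginalX (HSIC.productOfMarginals f) = marginalX f := by
    ext x
    simp only [marginalX.eq_1 (HSIC.productOfMarginals f), HSIC.productOfMarginals]
    rw [integral_const_mul, hf.integral_marginalY, mul_one]
  have h2 : marginalY (HSIC.productOfMarginals f) = marginalY f := by
    ext y
    simp only [marginalY.eq_1 (HSIC.productOfMarginals f), HSIC.productOfMarginals]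
    rw [integral_mul_const, hf.integral_marginalX, one_mul]
  ext z
  rw [HSIC.productOfMarginals, h1, h2]
  rfl

theorem IsDensity.measurable_dependencePart (hf : IsDensity f) : Measurable (dependencePart f) :=
  hf.1.sub hf.measurable_productOfMarginals

theorem IsDensity.integrable_dependencePart (hf : IsDensity f) :
    Integrable (dependencePart f) volume :=
  hf.integrable.sub hf.productOfMarginals.integrable

variable {M : ℝ}

theorem IsDensity.sq_dependencePart_le (hf : IsDensity f) (hM : ∀ᵐ z, f z ≤ M)
    (hM' : ∀ᵐ z, HSIC.productOfMarginals f z ≤ M) :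
    ∀ᵐ z, dependencePart f z ^ 2 ≤ M * (f z + HSIC.productOfMarginals f z) := by
  filter_upwards [hM, hM'] with z h h'
  exact sq_sub_le_mul_add (hf.2.1 z) (hf.productOfMarginals.2.1 z) h h'

theorem IsDensity.memLp_dependencePart (hf : IsDensity f) (hM : ∀ᵐ z, f z ≤ M)
    (hM' : ∀ᵐ z, HSIC.productOfMarginals f z ≤ M) : MemLp (dependencePart f) 2 volume := by
  rw [memLp_two_iff_integrable_sq hf.measurable_dependencePart.aestronglyMeasurable]
  refine ((hf.integrable.add hf.productOfMarginals.integrable).const_mul M).mono'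
    (hf.measurable_dependencePart.pow_const 2).aestronglyMeasurable ?_
  filter_upwards [hf.sq_dependencePart_le hM hM'] with z hz
  rw [Real.norm_of_nonneg (sq_nonneg _)]
  exact hz

/-- Since `ψ² ≤ M (f + f₁ ⊗ f₂)` almost everywhere, the total mass two gives the bound. It also
leaves no alternative to detect when `n < 4`. -/
theorem IsDensity.integral_sq_dependencePart_le (hf : IsDensity f) (hM : ∀ᵐ z, f z ≤ M)
    (hM' : ∀ᵐ z, HSIC.productOfMarginals f z ≤ M) : ∫ z, dependencePart f z ^ 2 ≤ 2 * M := by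
  refine (integral_mono_ae (hf.memLp_dependencePart hM hM').integrable_sq
    ((hf.integrable.add hf.productOfMarginals.integrable).const_mul M)
    (hf.sq_dependencePart_le hM hM')).trans (le_of_eq ?_)
  simp only [Pi.add_apply]
  rw [integral_const_mul, integral_add hf.integrable hf.productOfMarginals.integrable,
    hf.integral_eq_one, hf.productOfMarginals.integral_eq_one]
  ring

/-! ### Smoothing of the dependence part -/

/-- The convolution of `s` with the product of the Gaussian kernels. -/
def gaussianSmooth (lam : Fin p → ℝ) (mu : Fin q → ℝ) (s : Obs p q → ℝ) (z : Obs p q) : ℝ :=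
  ∫ z', gaussianKernel lam z.1 z'.1 * gaussianKernel mu z.2 z'.2 * s z'

variable {lam : Fin p → ℝ} {mu : Fin q → ℝ}

theorem measurable_productKernel (lam : Fin p → ℝ) (mu : Fin q → ℝ) (z : Obs p q) :
    Measurable fun z' : Obs p q => gaussianKernel lam z.1 z'.1 * gaussianKernel mu z.2 z'.2 := by
  refine Measurable.mul ?_ ?_
  · exact (measurable_gaussianKernel lam).comp (f := fun z' : Obs p q => (z.1, z'.1)) (by fun_prop)
  · exact (measurable_gaussianKernel mu).comp (f := fun z' : Obs p q => (z.2, z'.2)) (by fun_prop)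

theorem productKernel_nonneg (hlam : ∀ i, 0 < lam i) (hmu : ∀ j, 0 < mu j) (z z' : Obs p q) :
    0 ≤ gaussianKernel lam z.1 z'.1 * gaussianKernel mu z.2 z'.2 :=
  mul_nonneg (gaussianKernel_nonneg hlam _ _) (gaussianKernel_nonneg hmu _ _)

theorem productKernel_le (hlam : ∀ i, 0 < lam i) (hmu : ∀ j, 0 < mu j) (z z' : Obs p q) :
    gaussianKernel lam z.1 z'.1 * gaussianKernel mu z.2 z'.2 ≤
      (∏ i, lam i)⁻¹ * (∏ j, mu j)⁻¹ :=
  mul_le_mul (gaussianKernel_le hlam _ _) (gaussianKernel_le hmu _ _)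
    (gaussianKernel_nonneg hmu _ _) (inv_nonneg.2 (Finset.prod_nonneg fun i _ => (hlam i).le))

theorem integrable_productKernel_mul (hlam : ∀ i, 0 < lam i) (hmu : ∀ j, 0 < mu j)
    {s : Obs p q → ℝ} (hs : Integrable s volume) (z : Obs p q) : Integrable (fun z' =>
      gaussianKernel lam z.1 z'.1 * gaussianKernel mu z.2 z'.2 * s z') volume := by
  refine hs.bdd_mul (c := (∏ i, lam i)⁻¹ * (∏ j, mu j)⁻¹)
    (measurable_productKernel lam mu z).aestronglyMeasurable (ae_of_all _ fun z' => ?_)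
  rw [Real.norm_of_nonneg (productKernel_nonneg hlam hmu z z')]
  exact productKernel_le hlam hmu z z'

theorem integral_productKernel_obsLaw_le (hf : IsDensity f) (hM : ∀ᵐ z, f z ≤ M)
    (hlam : ∀ i, 0 < lam i) (hmu : ∀ j, 0 < mu j) (x : Fin p → ℝ) (y : Fin q → ℝ) :
    ∫ z', gaussianKernel lam x z'.1 * gaussianKernel mu y z'.2 ∂(obsLaw f) ≤ M := by
  rw [integral_obsLaw hf]
  have hi : Integrable (fun z' : Obs p q => gaussianKernel lam x z'.1 * gaussianKernel mu y z'.2)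
      volume := (integrable_gaussianKernel hlam x).mul_prod (integrable_gaussianKernel hmu y)
  calc ∫ z', f z' * (gaussianKernel lam x z'.1 * gaussianKernel mu y z'.2)
      ≤ ∫ z' : Obs p q, M * (gaussianKernel lam x z'.1 * gaussianKernel mu y z'.2) := by
        refine integral_mono_of_nonneg (ae_of_all _ fun z' => mul_nonneg (hf.2.1 z')
          (productKernel_nonneg hlam hmu (x, y) z')) (hi.const_mul M) ?_
        filter_upwards [hM] with z' hz'
        exact mul_le_mul_of_nonneg_right hz' (productKernel_nonneg hlam hmu (x, y) z')
    _ = M := by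
        rw [integral_const_mul, Measure.volume_eq_prod,
          integral_prod_mul (gaussianKernel lam x) (gaussianKernel mu y),
          integral_gaussianKernel hlam, integral_gaussianKernel hmu]
        ring

/-- This passes from the measure `P - P₁ ⊗ P₂` to its density. The kernel is bounded and both
densities are integrable, so the integrals may be subtracted at every point. -/
theorem dependencePotential_obsLaw (hf : IsDensity f) (hlam : ∀ i, 0 < lam i)
    (hmu : ∀ j, 0 < mu j) :
    dependencePotential (gaussianKernel lam) (gaussianKernel mu) (obsLaw f) =
      gaussianSmooth lam mu (dependencePart f) := by
  ext z
  have i1 := integrable_productKernel_mul hlam hmu hf.integrable z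
  have i2 := integrable_productKernel_mul hlam hmu hf.productOfMarginals.integrable z
  rw [dependencePotential, hf.prodMarginals_obsLaw, integral_obsLaw hf,
    integral_obsLaw hf.productOfMarginals, gaussianSmooth]
  simp only [dependencePart, mul_sub]
  rw [integral_sub i1 i2]
  simp only [mul_comm (f _), mul_comm (HSIC.productOfMarginals f _)]

theorem measurable_gaussianSmooth (hf : IsDensity f) (hlam : ∀ i, 0 < lam i)
    (hmu : ∀ j, 0 < mu j) : Measurable (gaussianSmooth lam mu (dependencePart f)) := by
  have := hf.isProbabilityMeasure
  rw [← dependencePotential_obsLaw hf hlam hmu]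
  exact measurable_dependencePotential _ (measurable_gaussianKernel lam)
    (measurable_gaussianKernel mu)

theorem abs_gaussianSmooth_le (hf : IsDensity f) (hlam : ∀ i, 0 < lam i)
    (hmu : ∀ j, 0 < mu j) (z : Obs p q) : |gaussianSmooth lam mu (dependencePart f) z| ≤
      2 * ((∏ i, lam i)⁻¹ * (∏ j, mu j)⁻¹) := by
  have := hf.isProbabilityMeasure
  rw [← dependencePotential_obsLaw hf hlam hmu]
  refine abs_dependencePotential_le _ (fun x x' y y' => ?_) z
  rw [abs_of_nonneg (productKernel_nonneg hlam hmu (x, y) (x', y'))]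
  exact productKernel_le hlam hmu (x, y) (x', y')

theorem integrable_density_mul_gaussianSmooth {g : Obs p q → ℝ} (hg : Integrable g volume)
    (hf : IsDensity f) (hlam : ∀ i, 0 < lam i) (hmu : ∀ j, 0 < mu j) :
    Integrable (fun z => g z * gaussianSmooth lam mu (dependencePart f) z) volume :=
  hg.mul_bdd (measurable_gaussianSmooth hf hlam hmu).aestronglyMeasurable
    (ae_of_all _ fun z => abs_gaussianSmooth_le hf hlam hmu z)

theorem dependenceEnergy_obsLaw (hf : IsDensity f) (hlam : ∀ i, 0 < lam i)
    (hmu : ∀ j, 0 < mu j) :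
    dependenceEnergy (gaussianKernel lam) (gaussianKernel mu) (obsLaw f) =
      ∫ z, dependencePart f z * gaussianSmooth lam mu (dependencePart f) z := by
  rw [dependenceEnergy, dependencePotential_obsLaw hf hlam hmu, hf.prodMarginals_obsLaw,
    integral_obsLaw hf, integral_obsLaw hf.productOfMarginals,
    ← integral_sub (integrable_density_mul_gaussianSmooth hf.integrable hf hlam hmu)
      (integrable_density_mul_gaussianSmooth hf.productOfMarginals.integrable hf hlam hmu)]
  refine integral_congr_ae (ae_of_all _ fun z => ?_)
  simp only [dependencePart]
  ring

theorem integral_obsLaw_le_mul {g φ : Obs p q → ℝ} (hg : IsDensity g) (hM : ∀ᵐ z, g z ≤ M)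
    (hφ0 : ∀ z, 0 ≤ φ z) (hφ : Integrable φ volume) : ∫ z, φ z ∂(obsLaw g) ≤ M * ∫ z, φ z := by
  rw [integral_obsLaw hg, ← integral_const_mul]
  refine integral_mono_of_nonneg (ae_of_all _ fun z => mul_nonneg (hg.2.1 z) (hφ0 z))
    (hφ.const_mul M) ?_
  filter_upwards [hM] with z hz
  exact mul_le_mul_of_nonneg_right hz (hφ0 z)

/-- Mean square deviation of the estimator under a law with bounded density. -/
theorem variance_hsicStat_density_le {n m : ℕ} (hm : 0 < m) (hmn : 4 * m ≤ n)
    (hf : IsDensity f) (hM : ∀ᵐ z, f z ≤ M) (hM' : ∀ᵐ z, HSIC.productOfMarginals f z ≤ M)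
    (hlam : ∀ i, 0 < lam i) (hmu : ∀ j, 0 < mu j)
    (hG : MemLp (gaussianSmooth lam mu (dependencePart f)) 2 volume) :
    Measurable (hsicStat n lam mu : (Fin n → Obs p q) → ℝ) ∧
    (∀ z : Fin n → Obs p q, |hsicStat n lam mu z| ≤ 4 * ((∏ i, lam i)⁻¹ * (∏ j, mu j)⁻¹)) ∧
    ∫ z, (hsicStat n lam mu z -
        ∫ z, dependencePart f z * gaussianSmooth lam mu (dependencePart f) z) ^ 2
        ∂(sampleLaw n f) ≤
      8 * M * (∫ z, gaussianSmooth lam mu (dependencePart f) z ^ 2) / m +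
        4 * M * ((∏ i, lam i)⁻¹ * (∏ j, mu j)⁻¹) / (m : ℝ) ^ 2 := by
  have := hf.isProbabilityMeasure
  have h := variance_hsicStat_le hm hmn lam mu (obsLaw f) (measurable_gaussianKernel lam)
    (measurable_gaussianKernel mu) (gaussianKernel_nonneg hlam) (gaussianKernel_nonneg hmu)
    (gaussianKernel_le hlam) (gaussianKernel_le hmu) (c := M)
    (integral_productKernel_obsLaw_le hf hM hlam hmu)
    (by
      rw [hf.prodMarginals_obsLaw]
      exact integral_productKernel_obsLaw_le hf.productOfMarginals hM' hlam hmu)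
  refine ⟨h.1, h.2.1, ?_⟩
  rw [dependenceEnergy_obsLaw hf hlam hmu, dependencePotential_obsLaw hf hlam hmu,
    hf.prodMarginals_obsLaw] at h
  refine h.2.2.trans ?_
  have h1 := integral_obsLaw_le_mul hf hM (fun z => sq_nonneg _) hG.integrable_sq
  have h2 := integral_obsLaw_le_mul hf.productOfMarginals hM' (fun z => sq_nonneg _)
    hG.integrable_sq
  exact add_le_add_left (div_le_div_of_nonneg_right (by linarith) (Nat.cast_nonneg m)) _

end Density

/-! ### Chebyshev bounds -/

theorem measure_le_of_integral_sq_le {Ω : Type*} [MeasurableSpace Ω] {P : Measure Ω}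
    [IsProbabilityMeasure P] {φ : Ω → ℝ} (hφ : Integrable (fun ω => φ ω ^ 2) P) {t β : ℝ}
    (ht : 0 < t) (h : ∫ ω, φ ω ^ 2 ∂P ≤ β * t ^ 2) :
    P {ω | t ≤ |φ ω|} ≤ ENNReal.ofReal β := by
  have h1 := mul_meas_ge_le_integral_of_nonneg (ae_of_all _ fun ω => sq_nonneg (φ ω)) hφ (t ^ 2)
  have e : {ω | t ^ 2 ≤ φ ω ^ 2} = {ω | t ≤ |φ ω|} := by
    ext ω
    simp only [Set.mem_ofPred_eq]
    rw [← sq_abs (φ ω)]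
    exact pow_le_pow_iff_left₀ ht.le (abs_nonneg _) two_ne_zero
  rw [e] at h1
  rw [← ofReal_measureReal]
  refine ENNReal.ofReal_le_ofReal ?_
  have ht2 : 0 < t ^ 2 := by positivity
  nlinarith

theorem quantile_le_of_integral_sq_le {Ω : Type*} [MeasurableSpace Ω] {P : Measure Ω}
    [IsProbabilityMeasure P] {T : Ω → ℝ} (hT : Measurable T)
    (hT2 : Integrable (fun ω => T ω ^ 2) P) {t α : ℝ} (ht : 0 < t) (hα : 0 ≤ α)
    (h : ∫ ω, T ω ^ 2 ∂P ≤ α * t ^ 2) : quantile P T (1 - α) ≤ t := by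
  have hmem : t ∈ {t : ℝ | ENNReal.ofReal (1 - α) ≤ P {ω | T ω ≤ t}} := by
    simp only [Set.mem_ofPred_eq]
    have h1 := measure_le_of_integral_sq_le hT2 ht h
    have h2 : P {ω | T ω ≤ t}ᶜ ≤ ENNReal.ofReal α := by
      refine (measure_mono fun ω hω => ?_).trans h1
      simp only [Set.mem_compl_iff, Set.mem_ofPred_eq, not_le] at hω ⊢
      exact hω.le.trans (le_abs_self _)
    rw [ENNReal.ofReal_sub _ hα, ENNReal.ofReal_one, tsub_le_iff_right]
    calc (1 : ℝ≥0∞) = P {ω | T ω ≤ t} + P {ω | T ω ≤ t}ᶜ :=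
          (prob_add_prob_compl (measurableSet_le hT measurable_const)).symm
      _ ≤ _ := by gcongr
  unfold quantile
  -- For a set unbounded below, `sInf` takes the default value 0, which is still at most `t`.
  by_cases hb : BddBelow {t : ℝ | ENNReal.ofReal (1 - α) ≤ P {ω | T ω ≤ t}}
  · exact csInf_le hb hmem
  · rw [Real.sInf_of_not_bddBelow hb]
    exact ht.le

theorem measure_le_of_mean_deviation {Ω : Type*} [MeasurableSpace Ω] {P : Measure Ω}
    [IsProbabilityMeasure P] {T : Ω → ℝ} {θ u β : ℝ}
    (hT2 : Integrable (fun ω => (T ω - θ) ^ 2) P) (hu : u < θ)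
    (h : ∫ ω, (T ω - θ) ^ 2 ∂P ≤ β * (θ - u) ^ 2) :
    P {ω | T ω ≤ u} ≤ ENNReal.ofReal β := by
  refine (measure_mono fun ω hω => ?_).trans
    (measure_le_of_integral_sq_le hT2 (sub_pos.2 hu) h)
  simp only [Set.mem_ofPred_eq] at hω ⊢
  rw [abs_sub_comm]
  exact (by linarith : θ - u ≤ θ - T ω).trans (le_abs_self _)

/-! ### Smoothing bias and the energy -/

/-- Averaging translates is an `L²` contraction, by Jensen's inequality and translation invariance.
-/
theorem eLpNorm_partialSmooth_le {ι : Type*} [Fintype ι] [DecidableEq ι] {s : (ι → ℝ) → ℝ}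
    (hs : Measurable s) (lam : ι → ℝ) (S : Finset ι) :
    eLpNorm (partialSmooth s lam S) 2 volume ≤ eLpNorm s 2 volume := by
  have key : eLpNorm (partialSmooth s lam S) 2 volume ^ 2 ≤ eLpNorm s 2 volume ^ 2 := by
    refine (eLpNorm_integral_sq_le (measurable_shifted hs lam S)).trans ?_
    simp only [eLpNorm_comp_add hs]
    simp
  exact le_of_not_gt fun hlt => absurd key (not_le.2 (ENNReal.pow_lt_pow_left two_ne_zero hlt))

section

variable {p q : ℕ} {f : Obs p q → ℝ} {lam : Fin p → ℝ} {mu : Fin q → ℝ}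

theorem eLpNorm_two_eq_ofReal_sqrt {Ω : Type*} [MeasurableSpace Ω] {μ : Measure Ω} {φ : Ω → ℝ}
    (hφ : MemLp φ 2 μ) : eLpNorm φ 2 μ = ENNReal.ofReal (Real.sqrt (∫ ω, φ ω ^ 2 ∂μ)) := by
  have h := eLpNorm_two_sq μ φ
  have e : ∫⁻ ω, ‖φ ω‖ₑ ^ 2 ∂μ = ENNReal.ofReal (∫ ω, φ ω ^ 2 ∂μ) := by
    rw [ofReal_integral_eq_lintegral_ofReal hφ.integrable_sq (ae_of_all _ fun ω => sq_nonneg _)]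
    refine lintegral_congr fun ω => ?_
    rw [Real.enorm_eq_ofReal_abs, ← ENNReal.ofReal_pow (abs_nonneg _), sq_abs]
  have h0 : 0 ≤ ∫ ω, φ ω ^ 2 ∂μ := integral_nonneg fun ω => sq_nonneg _
  rw [e, ← Real.sq_sqrt h0, ENNReal.ofReal_pow (Real.sqrt_nonneg _)] at h
  exact (ENNReal.pow_right_strictMono two_ne_zero).injective h

theorem memLp_gaussianSmooth (hf : IsDensity f) (hψ : MemLp (dependencePart f) 2 volume)
    (hlam : ∀ i, 0 < lam i) (hmu : ∀ j, 0 < mu j) :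
    MemLp (gaussianSmooth lam mu (dependencePart f)) 2 volume := by
  have hGm := measurable_gaussianSmooth hf hlam hmu
  refine ⟨hGm.aestronglyMeasurable, ?_⟩
  have hψm := hf.measurable_dependencePart
  refine lt_of_le_of_lt ?_ hψ.2
  have h := eLpNorm_partialSmooth_le (measurable_toCoordinates hψm) (Sum.elim lam mu) Finset.univ
  rw [partialSmooth_toCoordinates hψm hlam hmu, eLpNorm_toCoordinates hψm] at h
  exact (eLpNorm_toCoordinates hGm).symm.le.trans h

/-- The squared smoothing bias over a Nikol'skii-Besov ball. -/
theorem integral_smoothing_bias_sq_le (hf : IsDensity f)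
    (hψ : MemLp (dependencePart f) 2 volume) (hlam : ∀ i, 0 < lam i) (hmu : ∀ j, 0 < mu j)
    {ν : Fin p → ℝ} {γ : Fin q → ℝ} {R κ r : ℝ} (hR : 0 ≤ R) (hκ0 : 0 ≤ κ)
    (hball : toCoordinates (dependencePart f) ∈ nikolskiiBall (Sum.elim ν γ) R)
    (hν : ∀ i, 0 < ν i ∧ ν i ≤ 2) (hγ : ∀ j, 0 < γ j ∧ γ j ≤ 2)
    (hκ : ∀ r : ℝ, 0 < r → r ≤ 2 →
      ∫⁻ x, ENNReal.ofReal (|x| ^ r) ^ 2 ∂(ProbabilityTheory.gaussianReal 0 1) ≤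
        ENNReal.ofReal κ ^ 2)
    (hlr : ∀ i, lam i ^ ν i = r) (hmr : ∀ j, mu j ^ γ j = r) (hr : 0 ≤ r) :
    ∫ z, (dependencePart f z - gaussianSmooth lam mu (dependencePart f) z) ^ 2 ≤
      (κ * R * (p + q) * r) ^ 2 := by
  have hψm := hf.measurable_dependencePart
  have hGm := measurable_gaussianSmooth hf hlam hmu
  have hint : Integrable (toCoordinates (dependencePart f)) volume :=
    (measurePreserving_splitCoordinates p q).integrable_comp_of_integrable
      hf.integrable_dependencePart
  have h := eLpNorm_sub_partialSmooth_le (measurable_toCoordinates hψm) hint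
    (lam := Sum.elim lam mu) hR hκ0 hball
    (by rintro (i | j) <;> simp [(hlam _).le, (hmu _).le])
    (by rintro (i | j) <;> simp [hν, hγ])
    (by rintro (i | j)
        · exact hκ _ (hν i).1 (hν i).2
        · exact hκ _ (hγ j).1 (hγ j).2) Finset.univ
  rw [partialSmooth_toCoordinates hψm hlam hmu] at h
  have hd : Measurable fun z => dependencePart f z - gaussianSmooth lam mu (dependencePart f) z :=
    hψm.sub hGm
  have h' := (eLpNorm_toCoordinates hd).symm.le.trans h
  have hL2 : MemLp (fun z => dependencePart f z - gaussianSmooth lam mu (dependencePart f) z) 2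
      volume := hψ.sub (memLp_gaussianSmooth hf hψ hlam hmu)
  rw [eLpNorm_two_eq_ofReal_sqrt hL2, Fintype.sum_sum_type] at h'
  simp only [Sum.elim_inl, Sum.elim_inr, hlr, hmr, Finset.sum_const, Finset.card_univ,
    Fintype.card_fin, nsmul_eq_mul] at h'
  have hnn : 0 ≤ κ * R * (p * r + q * r) := by positivity
  rw [ENNReal.ofReal_le_ofReal_iff hnn, Real.sqrt_le_left hnn] at h'
  refine h'.trans (le_of_eq ?_)
  ring

/-- Polarisation, `2ab = a² + b² - (a - b)²`. The positive term in the squared norm of the smoothed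
function is what later compensates the leading variance term. -/
theorem integral_mul_gaussianSmooth_eq (hf : IsDensity f)
    (hψ : MemLp (dependencePart f) 2 volume) (hlam : ∀ i, 0 < lam i) (hmu : ∀ j, 0 < mu j) :
    ∫ z, dependencePart f z * gaussianSmooth lam mu (dependencePart f) z =
      1 / 2 * ((∫ z, dependencePart f z ^ 2) +
        (∫ z, gaussianSmooth lam mu (dependencePart f) z ^ 2) -
        ∫ z, (dependencePart f z - gaussianSmooth lam mu (dependencePart f) z) ^ 2) := by
  have hG := memLp_gaussianSmooth hf hψ hlam hmu
  have i1 := hψ.integrable_sq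
  have i2 := hG.integrable_sq
  have i3 := (hψ.sub hG).integrable_sq
  have i3' : Integrable (fun z => (dependencePart f z -
    gaussianSmooth lam mu (dependencePart f) z) ^ 2) volume := i3
  have i12 : Integrable (fun z => dependencePart f z ^ 2 +
    gaussianSmooth lam mu (dependencePart f) z ^ 2) volume := i1.add i2
  rw [← integral_add i1 i2, ← integral_sub i12 i3', ← integral_const_mul]
  refine integral_congr_ae (ae_of_all _ fun z => ?_)
  simp only
  ring

/-! ### The class of densities -/

theorem ae_le_of_eLpNorm_top_le {Ω : Type*} [MeasurableSpace Ω] {μ : Measure Ω} {φ : Ω → ℝ}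
    {M : ℝ} (hM : 0 ≤ M) (h : eLpNorm φ ∞ μ ≤ ENNReal.ofReal M) : ∀ᵐ ω ∂μ, φ ω ≤ M := by
  rw [eLpNorm_exponent_top] at h
  filter_upwards [ae_le_eLpNormEssSup (f := φ) (μ := μ)] with ω hω
  have := hω.trans h
  rw [Real.enorm_eq_ofReal_abs, ENNReal.ofReal_le_ofReal_iff hM] at this
  exact (le_abs_self _).trans this

/-- The joint density is at most `R'` and the product of the marginals at most `R' ^ 2`; the sum
serves for both. -/
theorem nikolskiiClass_bounds {ν : Fin p → ℝ} {γ : Fin q → ℝ} {R R' : ℝ} (hR' : 0 ≤ R')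
    (hf : f ∈ nikolskiiClass ν γ R R') :
    (∀ᵐ z, f z ≤ R' + R' ^ 2) ∧ ∀ᵐ z, productOfMarginals f z ≤ R' + R' ^ 2 := by
  obtain ⟨hd, -, hb⟩ := hf
  have h1 := ae_le_of_eLpNorm_top_le hR' ((le_max_left _ _).trans hb)
  have h2 := ae_le_of_eLpNorm_top_le hR'
    ((le_max_left _ _).trans ((le_max_right _ _).trans hb))
  have h3 := ae_le_of_eLpNorm_top_le hR'
    ((le_max_right _ _).trans ((le_max_right _ _).trans hb))
  refine ⟨?_, ?_⟩
  · filter_upwards [h1] with z hz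
    nlinarith [sq_nonneg R']
  · have h2' : ∀ᵐ z : Obs p q, marginalX f z.1 ≤ R' :=
      Measure.quasiMeasurePreserving_fst.ae h2
    have h3' : ∀ᵐ z : Obs p q, marginalY f z.2 ≤ R' :=
      Measure.quasiMeasurePreserving_snd.ae h3
    filter_upwards [h2', h3'] with z hx hy
    have := mul_le_mul hx hy (hd.marginalY_nonneg _) hR'
    simp only [productOfMarginals]
    nlinarith

end

/-! ### Second kind error -/

section

variable {p q : ℕ} {f : Obs p q → ℝ} {lam : Fin p → ℝ} {mu : Fin q → ℝ}

/-- Under independence both the mean and the projection term vanish, and Chebyshev's inequality is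
applied to the remaining term of order `1 / m²`. -/
theorem quantile_hsicStat_le {n m : ℕ} (hm : 0 < m) (hmn : 4 * m ≤ n) (hf : IsDensity f) {M : ℝ}
    (hM' : ∀ᵐ z, productOfMarginals f z ≤ M) (hlam : ∀ i, 0 < lam i) (hmu : ∀ j, 0 < mu j)
    {α t : ℝ} (hα : 0 ≤ α) (ht : 0 < t)
    (h : 4 * M * ((∏ i, lam i)⁻¹ * (∏ j, mu j)⁻¹) / (m : ℝ) ^ 2 ≤ α * t ^ 2) :
    quantile (sampleLaw n (productOfMarginals f)) (hsicStat n lam mu) (1 - α) ≤ t := by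
  have h0 : dependencePart (productOfMarginals f) = fun _ => 0 := by
    ext z
    simp [dependencePart, hf.productOfMarginals_idem]
  have hG0 : gaussianSmooth lam mu (dependencePart (productOfMarginals f)) = fun _ => 0 := by
    ext z
    simp [gaussianSmooth, h0]
  have hv := variance_hsicStat_density_le hm hmn hf.productOfMarginals hM'
    (by rw [hf.productOfMarginals_idem]; exact hM') hlam hmu (by rw [hG0]; exact MemLp.zero')
  rw [hG0, h0] at hv
  simp at hv
  have := hf.productOfMarginals.isProbabilityMeasure
  have : IsProbabilityMeasure (sampleLaw n (productOfMarginals f)) :=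
    Measure.pi.instIsProbabilityMeasure fun _ : Fin n => obsLaw (productOfMarginals f)
  exact quantile_le_of_integral_sq_le hv.1 (integrable_sq_of_abs_le hv.1 hv.2.1) ht hα
    (hv.2.2.trans h)

end

section

variable {p q : ℕ} {f : Obs p q → ℝ} {lam : Fin p → ℝ} {mu : Fin q → ℝ}

/-- The second kind error is at most `β` as soon as the squared `L²` norm of the dependence part
exceeds the squared bias, the critical value and the standard deviation. -/
theorem second_kind_error_le {n m : ℕ} (hm : 0 < m) (hmn : 4 * m ≤ n) (hf : IsDensity f) {M : ℝ}
    (hM : ∀ᵐ z, f z ≤ M) (hM' : ∀ᵐ z, productOfMarginals f z ≤ M) (hM0 : 0 ≤ M)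
    (hlam : ∀ i, 0 < lam i) (hmu : ∀ j, 0 < mu j) {α β r c A D : ℝ} (hα : 0 < α)
    (hβ : 0 < β) (hr : 0 < r) (hmr : 1 / (m : ℝ) ≤ 8 * r ^ 2)
    (hBr : ((∏ i, lam i)⁻¹ * (∏ j, mu j)⁻¹) / (m : ℝ) ^ 2 ≤ 64 * r ^ 4)
    (hbias : ∫ z, (dependencePart f z - gaussianSmooth lam mu (dependencePart f) z) ^ 2 ≤
      (c * r) ^ 2)
    (hA : 64 * M ≤ β * A) (hA1 : 1 ≤ A) (hA' : 256 * M ≤ β * A) (hD : 256 * M ≤ α * D)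
    (hD1 : 1 ≤ D)
    (hsep : (c ^ 2 + 2 * A + 2 * D) * r ^ 2 ≤ ∫ z, dependencePart f z ^ 2) :
    sampleLaw n f {z | hsicTest n α lam mu f z = 0} ≤ ENNReal.ofReal β := by
  have hψ := hf.memLp_dependencePart hM hM'
  have hG := memLp_gaussianSmooth hf hψ hlam hmu
  have hθ := integral_mul_gaussianSmooth_eq hf hψ hlam hmu
  obtain ⟨hTm, hTb, hv⟩ := variance_hsicStat_density_le hm hmn hf hM hM' hlam hmu hG
  have hg0 : 0 ≤ ∫ z, gaussianSmooth lam mu (dependencePart f) z ^ 2 :=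
    integral_nonneg fun z => sq_nonneg _
  -- The critical value is at most `D * r ^ 2`: the null variance is at most `256 M r⁴ ≤ α D r⁴ ≤ α
  -- (D r²)²`, using `1 ≤ D`.
  have hq := quantile_hsicStat_le hm hmn hf hM' hlam hmu (α := α) (t := D * r ^ 2) hα.le
    (by positivity) (by
      have h1 := mul_le_mul_of_nonneg_left hBr (mul_nonneg (by norm_num : (0 : ℝ) ≤ 4) hM0)
      have h2 : 256 * M * r ^ 4 ≤ α * D * r ^ 4 := mul_le_mul_of_nonneg_right hD (by positivity)
      have h3 : α * D * r ^ 4 * 1 ≤ α * D * r ^ 4 * D :=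
        mul_le_mul_of_nonneg_left hD1 (by positivity)
      rw [mul_div_assoc]
      nlinarith)
  have hset : {z | hsicTest n α lam mu f z = 0} = {z | hsicStat n lam mu z ≤
      quantile (sampleLaw n (productOfMarginals f)) (hsicStat n lam mu) (1 - α)} := by
    ext z
    simp [hsicTest]
  rw [hset]
  generalize quantile (sampleLaw n (productOfMarginals f)) (hsicStat n lam mu) (1 - α) = u at hq
  generalize (∫ z, dependencePart f z * gaussianSmooth lam mu (dependencePart f) z) = θ at hθ hv
  generalize (∫ z, gaussianSmooth lam mu (dependencePart f) z ^ 2) = g at hθ hv hg0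
  generalize (∫ z, dependencePart f z ^ 2) = N at hθ hsep
  generalize (∫ z, (dependencePart f z - gaussianSmooth lam mu (dependencePart f) z) ^ 2) = b
    at hθ hbias
  generalize ((∏ i, lam i)⁻¹ * (∏ j, mu j)⁻¹) = B at hv hBr hTb
  have := hf.isProbabilityMeasure
  have : IsProbabilityMeasure (sampleLaw n f) :=
    Measure.pi.instIsProbabilityMeasure fun _ : Fin n => obsLaw f
  have hr2 : 0 < r ^ 2 := by positivity
  -- In `θ = (N + g - b) / 2`, the part `c² r²` of `N` pays for the bias `b` and `2 D r²` for the
  -- critical value; `2 A r²` and `g` are left, halved.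
  have hgap : 1 / 2 * g + A * r ^ 2 ≤ θ - u := by nlinarith
  have hpos : 0 < 1 / 2 * g + A * r ^ 2 := by positivity
  refine measure_le_of_mean_deviation (θ := θ)
    (integrable_sq_of_abs_le (hTm.sub_const θ) (K := 4 * B + |θ|) fun z =>
      (abs_sub _ _).trans (by linarith [hTb z])) (by linarith) (hv.trans ?_)
  have hsq : (1 / 2 * g + A * r ^ 2) ^ 2 ≤ (θ - u) ^ 2 := pow_le_pow_left₀ hpos.le hgap 2
  have h1 : 8 * M * g / m ≤ 64 * M * g * r ^ 2 := by
    have := mul_le_mul_of_nonneg_left hmr (mul_nonneg (mul_nonneg (by norm_num : (0 : ℝ) ≤ 8) hM0)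
      hg0)
    calc 8 * M * g / m = 8 * M * g * (1 / (m : ℝ)) := by ring
      _ ≤ _ := this
      _ = _ := by ring
  have h2 : 4 * M * B / (m : ℝ) ^ 2 ≤ 256 * M * r ^ 4 := by
    have := mul_le_mul_of_nonneg_left hBr (mul_nonneg (by norm_num : (0 : ℝ) ≤ 4) hM0)
    calc 4 * M * B / (m : ℝ) ^ 2 = 4 * M * (B / (m : ℝ) ^ 2) := by ring
      _ ≤ _ := this
      _ = _ := by ring
  -- In the square of `g / 2 + A r²`, the cross term `A g r²` absorbs the variance term linear in
  -- `g`, and `A² r⁴` absorbs the other one.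
  have h3 : 64 * M * (g * r ^ 2) ≤ β * A * (g * r ^ 2) :=
    mul_le_mul_of_nonneg_right hA (by positivity)
  have h4 : 256 * M * r ^ 4 ≤ β * A * r ^ 4 := mul_le_mul_of_nonneg_right hA' (by positivity)
  have h5 : β * A * r ^ 4 * 1 ≤ β * A * r ^ 4 * A :=
    mul_le_mul_of_nonneg_left hA1 (by positivity)
  have h6 : β * (1 / 2 * g + A * r ^ 2) ^ 2 ≤ β * (θ - u) ^ 2 :=
    mul_le_mul_of_nonneg_left hsq hβ.le
  have h7 : 0 ≤ β * g ^ 2 := by positivity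
  nlinarith

theorem separationRate_le {n : ℕ} {Δ : (Obs p q → ℝ) → (Fin n → Obs p q) → ℕ}
    {𝒞 : Set (Obs p q → ℝ)} {β ρ : ℝ} (hρ : 0 < ρ)
    (h : ∀ f ∈ 𝒞, ENNReal.ofReal ρ < eLpNorm (dependencePart f) 2 volume →
      sampleLaw n f {z | Δ f z = 0} ≤ ENNReal.ofReal β) :
    separationRate n Δ 𝒞 β ≤ ENNReal.ofReal ρ :=
  sInf_le ⟨ρ, hρ, rfl, iSup₂_le fun f hf => h f hf.1 hf.2⟩

end

/-! ### The optimal bandwidths -/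

section

variable {d : ℕ} {n : ℕ} {η : ℝ} {r : Fin d → ℝ}

theorem optimalBandwidth_pos (hn : 0 < n) (i : Fin d) : 0 < optimalBandwidth n η r i :=
  Real.rpow_pos_of_pos (by exact_mod_cast hn) _

/-- The bandwidths are chosen so that every coordinate contributes the same bias. -/
theorem optimalBandwidth_rpow (i : Fin d) (hr : 0 < r i) :
    optimalBandwidth n η r i ^ r i = (n : ℝ) ^ (-(2 * η) / (1 + 4 * η)) := by
  unfold optimalBandwidth
  rw [← Real.rpow_mul (Nat.cast_nonneg n)]
  congr 1
  rw [mul_comm (r i), ← div_div, div_mul_cancel₀ _ hr.ne']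

theorem prod_optimalBandwidth (hn : 0 < n) :
    ∏ i, optimalBandwidth n η r i =
      (n : ℝ) ^ (-(2 * η) / (1 + 4 * η) * ∑ i, 1 / r i) := by
  unfold optimalBandwidth
  rw [← Real.rpow_sum_of_pos (by exact_mod_cast hn), Finset.mul_sum]
  congr 1
  refine Finset.sum_congr rfl fun i _ => ?_
  rw [mul_comm (r i), ← div_div, div_eq_mul_one_div (_ / _)]

end

theorem prod_mul_prod_optimalBandwidth {p q n : ℕ} (hn : 0 < n) {η : ℝ} (hη0 : 0 < η)
    {ν : Fin p → ℝ} {γ : Fin q → ℝ} (hη : 1 / η = (∑ i, 1 / ν i) + ∑ j, 1 / γ j) :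
    (∏ i, optimalBandwidth n η ν i) * ∏ j, optimalBandwidth n η γ j =
      (n : ℝ) ^ (-2 / (1 + 4 * η)) := by
  rw [prod_optimalBandwidth hn, prod_optimalBandwidth hn, ← Real.rpow_add (by exact_mod_cast hn),
    ← mul_add, ← hη]
  congr 1
  field_simp

theorem one_lt_log_inv {α : ℝ} (hα0 : 0 < α) (hα1 : α < 1 / Real.exp 1) :
    1 < Real.log (1 / α) := by
  rw [Real.lt_log_iff_exp_lt (by positivity)]
  rwa [lt_div_iff₀ hα0, mul_comm, ← lt_div_iff₀ (Real.exp_pos 1)]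

/-- Since `n * sqrt (∏ λ ∏ μ) = n ^ (4η / (1 + 4η))` and this exponent is the inverse of `1 + 1 /
(4η)`, the lower bound on `n` is exactly the second condition. The products are below one because
`p, q ≥ 1` make their exponents negative. -/
theorem bandwidthCondition_optimalBandwidth {p q n : ℕ} (hp : 1 ≤ p) (hq : 1 ≤ q) {α : ℝ}
    (hα : 1 < Real.log (1 / α)) {ν : Fin p → ℝ} {γ : Fin q → ℝ} (hν : ∀ i, 0 < ν i)
    (hγ : ∀ j, 0 < γ j) {η : ℝ} (hη0 : 0 < η)
    (hη : 1 / η = (∑ i, 1 / ν i) + ∑ j, 1 / γ j)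
    (hn : Real.log (1 / α) ^ (1 + 1 / (4 * η)) < n) :
    BandwidthCondition n α (optimalBandwidth n η ν) (optimalBandwidth n η γ) := by
  have hn1 : (1 : ℝ) < n := (Real.one_lt_rpow hα (by positivity)).trans hn
  have hn0 : 0 < n := by
    have : (0 : ℝ) < n := by linarith
    exact_mod_cast this
  have hlt : ∀ {d : ℕ} (r : Fin d → ℝ), 1 ≤ d → (∀ i, 0 < r i) →
      ∏ i, optimalBandwidth n η r i < 1 := by
    intro d r hd hr
    have : Nonempty (Fin d) := ⟨⟨0, hd⟩⟩
    rw [prod_optimalBandwidth hn0]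
    refine Real.rpow_lt_one_of_one_lt_of_neg hn1 ?_
    have hs : 0 < ∑ i, 1 / r i :=
      Finset.sum_pos (fun i _ => one_div_pos.2 (hr i)) Finset.univ_nonempty
    have : 0 < 2 * η / (1 + 4 * η) := by positivity
    rw [neg_div]
    nlinarith
  refine ⟨max_lt (hlt ν hp hν) (hlt γ hq hγ), ?_, hα⟩
  have e : (n : ℝ) * Real.sqrt ((n : ℝ) ^ (-2 / (1 + 4 * η))) =
      (n : ℝ) ^ (4 * η / (1 + 4 * η)) := by
    rw [Real.sqrt_eq_rpow, ← Real.rpow_mul (by linarith)]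
    nth_rewrite 1 [← Real.rpow_one (n : ℝ)]
    rw [← Real.rpow_add (by linarith)]
    congr 1
    field_simp
    ring
  rw [prod_mul_prod_optimalBandwidth hn0 hη0 hη, e]
  have h := Real.rpow_lt_rpow (Real.rpow_nonneg (by linarith) _) hn
    (by positivity : 0 < 4 * η / (1 + 4 * η))
  rw [← Real.rpow_mul (by linarith)] at h
  have e2 : (1 + 1 / (4 * η)) * (4 * η / (1 + 4 * η)) = 1 := by
    field_simp
    ring
  rwa [e2, Real.rpow_one] at h

theorem sq_add_le_add_sq {c x : ℝ} (hc : 0 ≤ c) (hx : 1 ≤ x) : c ^ 2 + x ≤ (c + x) ^ 2 := by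
  nlinarith [mul_nonneg hc (zero_le_one.trans hx)]

/-- With `m = n / 4` rounded down, `n ≤ 8 m` once `n ≥ 4`. Then `1 / n ≤ r²` because `4η / (1 + 4η)
≤ 1`, while `n ^ (2 / (1 + 4η)) / n² = r⁴` exactly, which is the balance fixing the rate. -/
theorem one_div_blocks_le {n : ℕ} (hn : 4 ≤ n) {η : ℝ} (hη : 0 < η) :
    1 / ((n / 4 : ℕ) : ℝ) ≤ 8 * ((n : ℝ) ^ (-(2 * η) / (1 + 4 * η))) ^ 2 ∧
    (n : ℝ) ^ (2 / (1 + 4 * η)) / ((n / 4 : ℕ) : ℝ) ^ 2 ≤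
      64 * ((n : ℝ) ^ (-(2 * η) / (1 + 4 * η))) ^ 4 := by
  have hm : 0 < n / 4 := by omega
  have hn8 : n ≤ 8 * (n / 4) := by omega
  have hn8' : (n : ℝ) ≤ 8 * ((n / 4 : ℕ) : ℝ) := by exact_mod_cast hn8
  have hmpos : (0 : ℝ) < ((n / 4 : ℕ) : ℝ) := by exact_mod_cast hm
  have hn1 : (1 : ℝ) ≤ n := by exact_mod_cast (by omega : 1 ≤ n)
  have hnpos : (0 : ℝ) < n := by linarith
  have hη4 : 0 < 1 + 4 * η := by linarith
  have hminv : 1 / ((n / 4 : ℕ) : ℝ) ≤ 8 * (n : ℝ) ^ (-1 : ℝ) := by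
    rw [Real.rpow_neg_one, ← div_eq_mul_inv, div_le_div_iff₀ hmpos hnpos]
    linarith
  constructor
  · refine hminv.trans (mul_le_mul_of_nonneg_left ?_ (by norm_num))
    rw [← Real.rpow_natCast, ← Real.rpow_mul hnpos.le]
    refine Real.rpow_le_rpow_of_exponent_le hn1 ?_
    push_cast
    rw [div_mul_eq_mul_div, le_div_iff₀ hη4]
    linarith
  · rw [div_eq_mul_one_div, ← one_div_pow]
    have h1 := pow_le_pow_left₀ (by positivity) hminv 2
    refine (mul_le_mul_of_nonneg_left h1 (by positivity)).trans (le_of_eq ?_)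
    have e1 : ((n : ℝ) ^ (-1 : ℝ)) ^ 2 = (n : ℝ) ^ (-2 : ℝ) := by
      rw [← Real.rpow_natCast, ← Real.rpow_mul hnpos.le]
      norm_num
    have e2 : ((n : ℝ) ^ (-(2 * η) / (1 + 4 * η))) ^ 4 =
        (n : ℝ) ^ (2 / (1 + 4 * η)) * (n : ℝ) ^ (-2 : ℝ) := by
      rw [← Real.rpow_natCast, ← Real.rpow_mul hnpos.le, ← Real.rpow_add hnpos]
      congr 1
      push_cast
      field_simp
      ring
    rw [mul_pow, e1, e2]
    ring

end HSIC

end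

/-! ### The separation rate at the optimal bandwidths -/

theorem corollaryA1 (p q : ℕ) (hp : 1 ≤ p) (hq : 1 ≤ q)
    (α β : ℝ) (hα0 : 0 < α) (hα1 : α < 1 / Real.exp 1) (hβ0 : 0 < β) (hβ1 : β < 1)
    (ν : Fin p → ℝ) (γ : Fin q → ℝ)
    (hν : ∀ i, 0 < ν i ∧ ν i ≤ 2) (hγ : ∀ j, 0 < γ j ∧ γ j ≤ 2)
    (R R' : ℝ) (hR : 0 < R) (hR' : 0 < R')
    (η : ℝ) (hη : 1 / η = (∑ i, 1 / ν i) + ∑ j, 1 / γ j) :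
    (∀ n : ℕ, (Real.log (1 / α)) ^ (1 + 1 / (4 * η)) < (n : ℝ) →
      HSIC.BandwidthCondition n α (HSIC.optimalBandwidth n η ν) (HSIC.optimalBandwidth n η γ)) ∧
    ∃ C : ℝ, 0 < C ∧ ∀ n : ℕ, (Real.log (1 / α)) ^ (1 + 1 / (4 * η)) ≤ (n : ℝ) →
      HSIC.separationRate n
          (HSIC.hsicTest n α (HSIC.optimalBandwidth n η ν) (HSIC.optimalBandwidth n η γ))
          (HSIC.nikolskiiClass ν γ R R') β
        ≤ ENNReal.ofReal (C * (n : ℝ) ^ (-(2 * η) / (1 + 4 * η))) := by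
  have hlog := HSIC.one_lt_log_inv hα0 hα1
  have hη0 : 0 < η := by
    have : Nonempty (Fin p) := ⟨⟨0, hp⟩⟩
    have h1 : 0 < ∑ i, 1 / ν i :=
      Finset.sum_pos (fun i _ => one_div_pos.2 (hν i).1) Finset.univ_nonempty
    have h2 : 0 ≤ ∑ j, 1 / γ j := Finset.sum_nonneg fun j _ => (one_div_pos.2 (hγ j).1).le
    rw [← one_div_pos, hη]
    linarith
  refine ⟨fun n hn => HSIC.bandwidthCondition_optimalBandwidth hp hq hlog (fun i => (hν i).1)
    (fun j => (hγ j).1) hη0 hη hn, ?_⟩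
  obtain ⟨κ, hκ0, hκ⟩ := HSIC.gaussian_moment_bound
  obtain ⟨M, hM0, hbounds⟩ : ∃ M : ℝ, 0 < M ∧ ∀ f ∈ HSIC.nikolskiiClass ν γ R R',
      (∀ᵐ z, f z ≤ M) ∧ ∀ᵐ z, HSIC.productOfMarginals f z ≤ M :=
    ⟨_, by positivity, fun f hf => HSIC.nikolskiiClass_bounds hR'.le hf⟩
  obtain ⟨c, hc0, hc⟩ : ∃ c : ℝ, 0 ≤ c ∧ κ * R * (p + q) = c := ⟨_, by positivity, rfl⟩
  have hconst : ∀ a : ℝ, 0 < a → ∃ A : ℝ, 1 ≤ A ∧ 256 * M ≤ a * A := fun a ha =>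
    ⟨256 * M / a + 1, le_add_of_nonneg_left (by positivity), by
      rw [mul_add, mul_div_cancel₀ _ ha.ne']
      linarith⟩
  obtain ⟨A, hA1, hβA⟩ := hconst β hβ0
  obtain ⟨D, hD1, hαD⟩ := hconst α hα0
  -- The first three terms give `c² + 2A + 2D ≤ C²`, the separation required by
  -- `second_kind_error_le`; the last one settles `n < 4`.
  refine ⟨c + 2 * A + 2 * D + 3 * (2 * M + 1), by positivity, fun n hn => ?_⟩
  obtain ⟨C, hC⟩ : ∃ C, c + 2 * A + 2 * D + 3 * (2 * M + 1) = C := ⟨_, rfl⟩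
  have hC3 : 3 * (2 * M + 1) ≤ C := by linarith only [hC, hc0, hA1, hD1]
  have hCc : c ^ 2 + 2 * A + 2 * D ≤ C ^ 2 := by
    have h := pow_le_pow_left₀ (by positivity)
      (by linarith only [hC, hM0] : c + (2 * A + 2 * D) ≤ C) 2
    have h' : c ^ 2 + (2 * A + 2 * D) ≤ (c + (2 * A + 2 * D)) ^ 2 :=
      HSIC.sq_add_le_add_sq hc0 (by linarith only [hA1, hD1])
    linarith only [h, h']
  have hC0 : 0 < C := by linarith only [hC3, hM0]
  rw [hC]
  have hn1 : (1 : ℝ) < n := (Real.one_lt_rpow hlog (by positivity)).trans_le hn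
  have hnpos : (0 : ℝ) < n := by linarith
  have hn0 : 0 < n := by exact_mod_cast hnpos
  obtain ⟨r, hr⟩ : ∃ r, (n : ℝ) ^ (-(2 * η) / (1 + 4 * η)) = r := ⟨_, rfl⟩
  have hr0 : 0 < r := hr ▸ Real.rpow_pos_of_pos hnpos _
  rw [hr]
  refine HSIC.separationRate_le (by positivity) fun f hf hsep => ?_
  obtain ⟨hM, hM'⟩ := hbounds f hf
  have hd := hf.1
  have hψ := hd.memLp_dependencePart hM hM'
  have hN := hd.integral_sq_dependencePart_le hM hM'
  rw [HSIC.eLpNorm_two_eq_ofReal_sqrt hψ, ENNReal.ofReal_lt_ofReal_iff_of_nonneg (by positivity),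
    Real.lt_sqrt (by positivity)] at hsep
  rcases lt_or_ge n 4 with hn4 | hn4
  -- No alternative is that far: `n ≤ 3` gives `r ≥ 1 / n ≥ 1 / 3`, hence `C r ≥ 2M + 1`, while the
  -- squared norm of the dependence part is at most `2M < (2M + 1)²`.
  · exfalso
    have h3 : (n : ℝ) ≤ 3 := by exact_mod_cast Nat.lt_succ_iff.1 hn4
    have h13 : 1 / 3 ≤ r := by
      refine (one_div_le_one_div_of_le hnpos h3).trans ?_
      rw [one_div, ← Real.rpow_neg_one]
      rw [← hr]
      refine Real.rpow_le_rpow_of_exponent_le hn1.le ?_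
      rw [le_div_iff₀ (by positivity)]
      linarith only [hη0]
    have hCr : 2 * M + 1 ≤ C * r := by
      have h := mul_le_mul hC3 h13 (by norm_num) hC0.le
      linarith only [h]
    have h := pow_le_pow_left₀ (by positivity) hCr 2
    have h' : 2 * M < (2 * M + 1) ^ 2 := by nlinarith only [hM0]
    linarith only [h, h', hsep, hN]
  · have hm : 0 < n / 4 := by omega
    have hlam : ∀ i, 0 < HSIC.optimalBandwidth n η ν i := HSIC.optimalBandwidth_pos hn0
    have hmu : ∀ j, 0 < HSIC.optimalBandwidth n η γ j := HSIC.optimalBandwidth_pos hn0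
    refine HSIC.second_kind_error_le (r := r) (c := c) (A := A) (D := D) (m := n / 4) hm (by omega)
      hd hM hM' hM0.le hlam hmu hα0 hβ0 hr0 ?_ ?_ ?_ (by linarith only [hβA, hM0]) hA1 hβA
      hαD hD1 ?_
    · exact hr ▸ (HSIC.one_div_blocks_le hn4 hη0).1
    · have h := (HSIC.one_div_blocks_le hn4 hη0).2
      rw [← mul_inv, HSIC.prod_mul_prod_optimalBandwidth hn0 hη0 hη, ← Real.rpow_neg hnpos.le,
        neg_div, neg_neg, ← hr]
      exact h
    · rw [← hc]
      exact HSIC.integral_smoothing_bias_sq_le hd hψ hlam hmu hR.le hκ0.le hf.2.1 hν hγ hκ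
        (fun i => hr ▸ HSIC.optimalBandwidth_rpow i (hν i).1)
        (fun j => hr ▸ HSIC.optimalBandwidth_rpow j (hγ j).1) hr0.le
    · have := mul_le_mul_of_nonneg_right hCc (sq_nonneg r)
      rw [← mul_pow] at this
      exact this.trans hsep.le
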